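/- **Setting.** Let $T\in(0,\infty)$, let $(\Omega,\mathcal F,\mathbb P)$ be a complete probability space and $(K,\mathcal K)$ a Lusin (standard Borel) space. Let $(S_n,X_n)_{n\ge1}$ be a non-explosive marked point process: random variables $S_n$ with values in $(0,T]\cup\{\infty\}$ and $X_n$ with values in $K$, with $S_n\le S_{n+1}$ everywhere, almost surely $S_n<S_{n+1}$ whenever $S_n\le T$, for every $\omega$ some $S_n(\omega)=\infty$, and $X_n$ equal to a fixed point $\Delta\in K$ on $\{S_n=\infty\}$. Let $\mu(dt,dx)=\sum_{n:\,S_n\le T}\delta_{(S_n,X_n)}(dt,dx)$, let $(\mathcal F_t)$ be the smallest filtration for which every $S_n$ is a stopping time and every $X_n$ is $\mathcal F_{S_n}$-measurable, and let $\mathcal P$ be its predictable $\sigma$-field on $\Omega\times[0,T]$. For a measurable space $(G,\mathcal G)$, functions on $\Omega\times[0,T]\times G$ that are $\mathcal P\otimes\mathcal G$-measurable are called predictable. Let $\nu(\omega,dt,dx)=dA_t(\omega)\,\phi_{\omega,t}(dx)$ be the predictable compensator of $\mu$: $A$ is an increasing càdlàg predictable process with $A_0=0$, $\phi$ is a transition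 probability from $(\Omega\times[0,T],\mathcal P)$ to $(K,\mathcal K)$, and $\mathbb E\int\!\!\int H\,d\mu=\mathbb E\int\!\!\int H\,d\nu$ for every nonnegative predictable $H$ on $\Omega\times[0,T]\times K$. Assume that $A$ is almost surely continuous. Let $\mathcal B(K)$ denote the set of Borel functions $K\to\mathbb R$. Let $p>1$, $\beta\in\mathbb R$, $L,L'\ge0$, $\xi:\Omega\to\mathbb R$ and $f:\Omega\times[0,T]\times K\times\mathbb R\times\mathcal B(K)\to\mathbb R$. **Hypothesis (H).** 1. $\xi$ is $\mathcal F_T$-measurable and $\mathbb E\,e^{\beta A_T}|\xi|^p<\infty$. 2. For every predictable $Z$ on $\Omega\times[0,T]\times K$, the map $(\omega,t,x,y)\mapsto f(\omega,t,x,y,Z_{\omega,t}(\cdot))$ is predictable. 3. For all $\omega,t,x,y,y'$ and $\zeta,\zeta'\in\mathcal B(K)$: $|f(\omega,t,x,y',\zeta)-f(\omega,t,x,y,\zeta)|\le L'|y'-y|$ and $\int_K|f(\omega,t,x,y,\zeta)-f(\omega,t,x,y,\zeta')|\,\phi_{\omega,t}(dx)\le L\big(\int_K|\zeta'(v)-\zeta(v)|^p\,\phi_{\omega,t}(dv)\big)^{1/p}$.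 4. $\mathbb E\int_0^T\!\int_K e^{\beta A_t}|f(t,x,0,0)|^p\,\nu(dt,dx)<\infty$. A *solution* is a pair $(Y,Z)$ with $Y$ adapted and càdlàg and $Z$ predictable on $\Omega\times[0,T]\times K$, such that almost surely $\int_0^T\!\int_K|Z(s,x)|\,\nu(ds,dx)<\infty$, the integral of $f(s,x,Y_{s-},Z_s(\cdot))$ with respect to $\nu$ exists, and, for all $t\in[0,T]$, $$Y_t+\int_{(t,T]}\int_K Z(s,x)\,\mu(ds,dx)=\xi+\int_{(t,T]}\int_K f(s,x,Y_{s-},Z_s(\cdot))\,\nu(ds,dx).\qquad(1)$$ The pair $(Y,Z)$ belongs to $L^p_\beta$ if $Y$ is progressive, $Z$ is predictable, and $\mathbb E\int_0^T\!\int_K(|Y_s|^p+|Z(s,x)|^p)e^{\beta A_s}\,\nu(ds,dx)<\infty$. **Lemma.** Let $p>1$, $L,L'\ge0$, $\epsilon>0$, let $C_\epsilon=\Big(1-\big(\tfrac1{1+\epsilon}\big)^{\frac1{p-1}}\Big)^{1-p}$, and let $$\beta>1+\frac{C_\epsilon}{1+\epsilon}+pL'+(p-1)\big(L^p(1+\epsilon)\big)^{\frac1{p-1}}.$$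 Then there are constants $C_1,C_2$ depending only on $(\beta,p,L,L',\epsilon)$ such that, in the above setting and under Hypothesis (H) with this $\beta$, every solution $(Y,Z)$ of (1) that belongs to $L^p_\beta$ satisfies, for every $t\in[0,T]$, $$\mathbb E|Y_t|^pe^{\beta A_t}\le C_1\,\mathbb E\Big(|\xi|^pe^{\beta A_T}+\int_t^T\!\!\int_K|f(s,x,0,0)|^pe^{\beta A_s}\,\nu(ds,dx)\Big)$$ and $$\mathbb E\int_0^T\!\!\int_K\big(|Y_s|^p+|Z(s,x)|^p\big)e^{\beta A_s}\,\nu(ds,dx)\le C_2\,\mathbb E\Big(|\xi|^pe^{\beta A_T}+\int_0^T\!\!\int_K|f(s,x,0,0)|^pe^{\beta A_s}\,\nu(ds,dx)\Big).$$ -/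

import Mathlib

open MeasureTheory ProbabilityTheory Set Filter Topology
open scoped NNReal ENNReal

noncomputable section

namespace BSDE

/-- The time interval `[0, T]`, as a subtype of `ℝ≥0`. -/
abbrev Time (T : ℝ≥0) : Type := Set.Iic T

instance (T : ℝ≥0) : OrderBot (Time T) where
  bot := ⟨0, mem_Iic.mpr zero_le⟩
  bot_le t := Subtype.coe_le_coe.mp (zero_le (a := (t : ℝ≥0)))

instance (T : ℝ≥0) : CompactIccSpace (Time T) where
  isCompact_Icc {a b} := by
    rw [Subtype.isCompact_iff]
    convert (isCompact_Icc : IsCompact (Icc (a : ℝ≥0) b)) using 1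
    ext x
    exact ⟨fun ⟨y, hy, h⟩ => h ▸ hy, fun hx => ⟨⟨x, hx.2.trans b.2⟩, hx, rfl⟩⟩

/-- A non-explosive marked point process on `[0, T] × K`. The index `n : ℕ` stands for the
`(n + 1)`-st point, so `S 0` is the first jump time; `⊤` plays the role of `∞`. -/
structure MarkedPointProcess (T : ℝ≥0) (K : Type*) [MeasurableSpace K]
    {Ω : Type*} [MeasurableSpace Ω] (P : Measure Ω) where
  /-- the jump times, with values in `(0, T] ∪ {∞}` -/
  S : ℕ → Ω → WithTop (Time T)
  /-- the marks -/
  X : ℕ → Ω → K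
  /-- the mark attached to the points that do not occur -/
  Δ : K
  measurableSet_S_le : ∀ n (t : Time T), MeasurableSet {ω | S n ω ≤ t}
  measurable_X : ∀ n, Measurable (X n)
  S_pos : ∀ n ω, ((⊥ : Time T) : WithTop (Time T)) < S n ω
  S_le_succ : ∀ n ω, S n ω ≤ S (n + 1) ω
  S_lt_succ : ∀ᵐ ω ∂P, ∀ n, S n ω ≠ ⊤ → S n ω < S (n + 1) ω
  exists_S_eq_top : ∀ ω, ∃ n, S n ω = ⊤
  X_eq_of_S_eq_top : ∀ n ω, S n ω = ⊤ → X n ω = Δ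

namespace MarkedPointProcess

variable {T : ℝ≥0} {K Ω : Type*} [MeasurableSpace K] [MeasurableSpace Ω] {P : Measure Ω}

/-- The filtration generated by the point process: the smallest filtration for which each `S n`
is a stopping time and `X n` is measurable for the σ-field of the events prior to `S n`. -/
def filtration (N : MarkedPointProcess T K P) : Filtration (Time T) ‹MeasurableSpace Ω› :=
  sInf {G | ∀ n, ∃ h : IsStoppingTime G (N.S n), Measurable[h.measurableSpace] (N.X n)}

/-- The predictable σ-field on `[0, T] × Ω`. -/
abbrev predictable (N : MarkedPointProcess T K P) : MeasurableSpace (Time T × Ω) :=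
  N.filtration.predictable

/-- The random counting measure `μ(ω, dt, dx)`, the sum of the Dirac masses at the points
`(S n, X n)` with `S n ≤ T`. -/
def jumpMeasure (N : MarkedPointProcess T K P) (ω : Ω) : Measure (Time T × K) :=
  Measure.sum fun n => match N.S n ω with
    | ⊤ => 0
    | (t : Time T) => Measure.dirac (t, N.X n ω)

/-- Predictable functions on `Ω × [0, T] × K`. -/
def PredictableFun (N : MarkedPointProcess T K P) (Z : Time T → Ω → K → ℝ) : Prop :=
  Measurable[N.predictable.prod ‹MeasurableSpace K›]
    fun q : (Time T × Ω) × K => Z q.1.1 q.1.2 q.2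

end MarkedPointProcess

/-- The predictable σ-field is coarser than the product σ-field. -/
theorem predictable_le {T : ℝ≥0} {Ω : Type*} [m : MeasurableSpace Ω]
    (F : Filtration (Time T) m) : F.predictable ≤ Prod.instMeasurableSpace :=
  measurableSpace_le_predictable_of_measurableSet
    (fun A hA => (measurableSet_singleton _).prod (F.le _ A hA))
    (fun _ A hA => measurableSet_Ioi.prod (F.le _ A hA))

/-- The predictable compensator of the random measure `μ` of the point process, in disintegrated
form `ν(ω, dt, dx) = dA_t(ω) φ_{ω,t}(dx)`: `A` is an increasing, right-continuous predictable
process starting at `0`, `φ` is a transition probability from `([0, T] × Ω, predictable)` to `K`,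
and `E ∫ H dμ = E ∫ H dν` for every nonnegative predictable function `H`. -/
structure Compensator {T : ℝ≥0} {K Ω : Type*} [MeasurableSpace K] [MeasurableSpace Ω]
    {P : Measure Ω} (N : MarkedPointProcess T K P) where
  A : Ω → StieltjesFunction (Time T)
  A_bot : ∀ ω, A ω ⊥ = 0
  predictable_A : Measurable[N.predictable] fun q : Time T × Ω => A q.2 q.1
  φ : @Kernel (Time T × Ω) K N.predictable _
  isProbabilityMeasure_φ : ∀ q, IsProbabilityMeasure (φ q)
  lintegral_eq : ∀ H : (Time T × Ω) × K → ℝ≥0∞,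
    Measurable[N.predictable.prod ‹MeasurableSpace K›] H →
      ∫⁻ ω, ∫⁻ q, H ((q.1, ω), q.2) ∂(N.jumpMeasure ω) ∂P =
        ∫⁻ ω, ∫⁻ t, ∫⁻ x, H ((t, ω), x) ∂(φ (t, ω)) ∂(A ω).measure ∂P

namespace Compensator

variable {T : ℝ≥0} {K Ω : Type*} [MeasurableSpace K] [MeasurableSpace Ω] {P : Measure Ω}
  {N : MarkedPointProcess T K P}

/-- For fixed `ω`, the transition probability `t ↦ φ_{ω,t}` from `[0, T]` to `K`. -/
def section_φ (c : Compensator N) (ω : Ω) : Kernel (Time T) K where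
  toFun t := c.φ (t, ω)
  measurable' := (c.φ.measurable.mono (predictable_le N.filtration) le_rfl).comp
    measurable_prodMk_right

instance (c : Compensator N) (ω : Ω) : IsMarkovKernel (c.section_φ ω) :=
  ⟨fun t => c.isProbabilityMeasure_φ (t, ω)⟩

/-- The random measure `ν(ω, dt, dx) = dA_t(ω) φ_{ω,t}(dx)` on `[0, T] × K`. -/
def ν (c : Compensator N) (ω : Ω) : Measure (Time T × K) :=
  (c.A ω).measure.compProd (c.section_φ ω)

end Compensator

/-- Right-continuous with left limits. -/
def IsCadlag {T : ℝ≥0} (y : Time T → ℝ) : Prop :=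
  ∀ t, ContinuousWithinAt y (Ici t) t ∧ ∃ l, Tendsto y (𝓝[<] t) (𝓝 l)

section Equation

variable {T : ℝ≥0} {K Ω : Type*} [MeasurableSpace K] [MeasurableSpace Ω] {P : Measure Ω}
  {N : MarkedPointProcess T K P}

/-- `(Y, Z)` solves the backward equation
`Y_t + ∫_{(t,T]} ∫_K Z(s,x) μ(ds,dx) = ξ + ∫_{(t,T]} ∫_K f(s,x,Y_{s-},Z_s(·)) ν(ds,dx)`.
The field `integrable_f` says that the last integral exists. -/
structure IsSolution (c : Compensator N) (ξ : Ω → ℝ)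
    (f : Time T → Ω → K → ℝ → (K → ℝ) → ℝ) (Y : Time T → Ω → ℝ) (Z : Time T → Ω → K → ℝ) :
    Prop where
  adapted : Adapted N.filtration Y
  cadlag : ∀ ω, IsCadlag fun t => Y t ω
  predictable : N.PredictableFun Z
  integrable_Z : ∀ᵐ ω ∂P, ∫⁻ q, ENNReal.ofReal |Z q.1 ω q.2| ∂(c.ν ω) < ∞
  integrable_f : ∀ᵐ ω ∂P, Integrable
    (fun q : Time T × K => f q.1 ω q.2 (Function.leftLim (fun s => Y s ω) q.1) (Z q.1 ω)) (c.ν ω)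
  equation : ∀ᵐ ω ∂P, ∀ t : Time T,
    Y t ω + ∫ q in Ioi t ×ˢ univ, Z q.1 ω q.2 ∂(N.jumpMeasure ω) =
      ξ ω + ∫ q in Ioi t ×ˢ univ,
        f q.1 ω q.2 (Function.leftLim (fun s => Y s ω) q.1) (Z q.1 ω) ∂(c.ν ω)

/-- `E ∫_0^T ∫_K (|Y_s|^p + |Z(s,x)|^p) e^{β A_s} ν(ds,dx)`. -/
def normLp (c : Compensator N) (p β : ℝ) (Y : Time T → Ω → ℝ) (Z : Time T → Ω → K → ℝ) : ℝ≥0∞ :=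
  ∫⁻ ω, ∫⁻ q, ENNReal.ofReal
    ((|Y q.1 ω| ^ p + |Z q.1 ω q.2| ^ p) * Real.exp (β * c.A ω q.1)) ∂(c.ν ω) ∂P

/-- Membership of a pair of processes in `L^p_β`. -/
structure MemLpβ (c : Compensator N) (p β : ℝ) (Y : Time T → Ω → ℝ) (Z : Time T → Ω → K → ℝ) :
    Prop where
  progressive : IsProgressive N.filtration Y
  predictable : N.PredictableFun Z
  norm_lt_top : normLp c p β Y Z < ∞

/-- The assumptions on the final condition `ξ` and the generator `f`, with Lipschitz constants
`L'` in `y` and `L` in `ζ`. The space of Borel functions on `K` consists of the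
`ζ : K → ℝ` with `Measurable ζ`. -/
structure Hypothesis (c : Compensator N) (p β L L' : ℝ) (ξ : Ω → ℝ)
    (f : Time T → Ω → K → ℝ → (K → ℝ) → ℝ) : Prop where
  measurable_ξ : Measurable[N.filtration ⊤] ξ
  integrable_ξ : ∫⁻ ω, ENNReal.ofReal (Real.exp (β * c.A ω ⊤) * |ξ ω| ^ p) ∂P < ∞
  predictable_f : ∀ Z : Time T → Ω → K → ℝ, N.PredictableFun Z →
    Measurable[(N.predictable.prod ‹MeasurableSpace K›).prod Real.measurableSpace]
      fun q : ((Time T × Ω) × K) × ℝ => f q.1.1.1 q.1.1.2 q.1.2 q.2 (Z q.1.1.1 q.1.1.2)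
  lipschitz_y : ∀ t ω x y y' ζ, Measurable ζ → |f t ω x y' ζ - f t ω x y ζ| ≤ L' * |y' - y|
  lipschitz_ζ : ∀ t ω y ζ ζ', Measurable ζ → Measurable ζ' →
    ∫⁻ x, ENNReal.ofReal |f t ω x y ζ - f t ω x y ζ'| ∂(c.φ (t, ω)) ≤
      ENNReal.ofReal L * (∫⁻ v, ENNReal.ofReal (|ζ' v - ζ v| ^ p) ∂(c.φ (t, ω))) ^ (1 / p)
  integrable_f_zero : ∫⁻ ω, ∫⁻ q, ENNReal.ofReal
    (Real.exp (β * c.A ω q.1) * |f q.1 ω q.2 0 0| ^ p) ∂(c.ν ω) ∂P < ∞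

/-- `E (|ξ|^p e^{β A_T} + ∫_{(t,T]} ∫_K |f(s,x,0,0)|^p e^{β A_s} ν(ds,dx))`. -/
def dataBound (c : Compensator N) (p β : ℝ) (ξ : Ω → ℝ)
    (f : Time T → Ω → K → ℝ → (K → ℝ) → ℝ) (t : Time T) : ℝ≥0∞ :=
  ∫⁻ ω, (ENNReal.ofReal (|ξ ω| ^ p * Real.exp (β * c.A ω ⊤)) +
    ∫⁻ q in Ioi t ×ˢ univ, ENNReal.ofReal
      (|f q.1 ω q.2 0 0| ^ p * Real.exp (β * c.A ω q.1)) ∂(c.ν ω)) ∂P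

end Equation

/-- The constant `C_ε = (1 - (1 / (1 + ε)) ^ (1 / (p - 1))) ^ (1 - p)`. -/
def Cε (p ε : ℝ) : ℝ := (1 - (1 / (1 + ε)) ^ (1 / (p - 1))) ^ (1 - p)

end BSDE

end

/-! A path of a solution is elementary: finitely many jumps of size `Z` plus a part with a density
with respect to the continuous measure dA. The ordinary chain rule, with no stochastic calculus,
therefore applies to |Y|^p e^{βA}: `comp_eq_of_jumps`, `rpow_abs_mul_exp_eq`. It produces β∫|Y|^p
e^{βA} dA and the jump terms (|Y_- + Z|^p - |Y_-|^p) e^{βA}. In expectation the compensator turns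
sums over jumps into ν-integrals; this requires Y_-, which is predictable and equals Y dA-almost
everywhere. The two halves of the jump term are kept on opposite sides, so every quantity is
nonnegative and no martingale or integrability argument is needed.

Two inequalities finish the proof. `rpow_abs_le`, |Z|^p ≤ (1+ε)|Y_- + Z|^p + C_ε|Y_-|^p, makes the
jump term control 1/(1+ε) times the Z-norm, at the price 1 + C_ε/(1+ε) on the Y-norm. Young's
inequality with parameters δ and c bounds the driver by coefficients (p-1)δ + pL' + (p-1)c on Y, L^p
c^{1-p} on Z and δ^{1-p} on f(·,0,0) (`ofReal_mul_abs_integral_le`). The lower bound on β is what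
permits L^p c^{1-p} < 1/(1+ε) while β still exceeds the total price on Y. Membership in L^p_β makes
the absorbed terms finite (`estimate_of_le`). -/

namespace BSDE

/-! ### Chain rule for paths with finitely many jumps. -/

variable {T : ℝ≥0}

/-- A continuous function whose right increments are negligible compared with those of a
continuous function is constant. -/
theorem eq_of_forall_increment_le {D M : Time T → ℝ} (hD : Continuous D) (hM : Continuous M)
    (h : ∀ t, t < ⊤ → ∀ η : ℝ, 0 < η → ∀ᶠ s in 𝓝[>] t, |D s - D t| ≤ η * (M s - M t))
    (t : Time T) : D t = D ⊤ := by
  -- Continuous induction along [t, T] needs a conditionally complete order, which `Time T` inherits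
  -- as an order-connected set.
  let _ : Inhabited (Time T) := ⟨⊥⟩
  let _ : ConditionallyCompleteLinearOrder (Time T) :=
    ordConnectedSubsetConditionallyCompleteLinearOrder (Iic T)
  have key : ∀ η : ℝ, 0 < η → |D ⊤ - D t| ≤ η * (M ⊤ - M t) := by
    intro η hη
    have hcl : IsClosed {s | |D s - D t| ≤ η * (M s - M t)} :=
      isClosed_le (by fun_prop) (by fun_prop)
    have := IsClosed.Icc_subset_of_forall_exists_gt (α := Time T)
      (hcl.inter (isClosed_Icc (a := t) (b := ⊤))) (by simp)
      (fun s hs r hr => ?_)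
    · exact this ⟨le_top, le_rfl⟩
    · have hlt : s < ⊤ := hs.2.2
      have : (𝓝[>] s).NeBot := nhdsGT_neBot_of_exists_gt ⟨⊤, hlt⟩
      obtain ⟨r', h1, h2⟩ := ((h s hlt η hη).and (Ioc_mem_nhdsGT hr)).exists
      refine ⟨r', ?_, h2⟩
      have := hs.1
      simp only [mem_ofPred_eq] at this ⊢
      calc |D r' - D t| ≤ |D r' - D s| + |D s - D t| := abs_sub_le _ _ _
        _ ≤ _ := by linarith
  by_contra hne
  have hpos : 0 < |D ⊤ - D t| := abs_pos.2 (sub_ne_zero.2 (Ne.symm hne))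
  have h1 := key 1 one_pos
  -- This η would give |D ⊤ - D t| ≤ |D ⊤ - D t| / 2.
  have h2 := key (|D ⊤ - D t| / (2 * (M ⊤ - M t))) (by apply div_pos hpos; linarith)
  have h3 : M ⊤ - M t ≠ 0 := by intro h0; rw [h0] at h1; linarith
  field_simp at h2
  linarith

/-- Dominated convergence: the indicator of (t, T] at r is locally constant in t except at t = r,
and points have no mass. -/
theorem continuous_setIntegral_Ioi {E : Type*} [NormedAddCommGroup E] [NormedSpace ℝ E]
    {m : Measure (Time T)} [NullSingletonClass m] {h : Time T → E} (hh : Integrable h m) :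
    Continuous fun t => ∫ r in Ioi t, h r ∂m := by
  simp_rw [← integral_indicator measurableSet_Ioi]
  refine continuous_iff_continuousAt.2 fun t => ?_
  refine continuousAt_of_dominated (bound := fun r => ‖h r‖) ?_ ?_ hh.norm ?_
  · exact Eventually.of_forall fun s => hh.1.indicator measurableSet_Ioi
  · exact Eventually.of_forall fun s => Eventually.of_forall fun r => norm_indicator_le_norm_self _ _
  · have : ∀ᵐ r ∂m, r ≠ t := by simp [ae_iff]
    filter_upwards [this] with r hr
    rcases lt_or_gt_of_ne hr with hr | hr
    · refine (continuousAt_const (y := (0 : E))).congr ?_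
      filter_upwards [Ioi_mem_nhds hr] with s hs
      rw [indicator_of_notMem]
      simpa using le_of_lt hs
    · refine (continuousAt_const (y := h r)).congr ?_
      filter_upwards [Iio_mem_nhds hr] with s hs
      rw [indicator_of_mem]
      simpa using hs

theorem setIntegral_Ioi_sub {E : Type*} [NormedAddCommGroup E] [NormedSpace ℝ E]
    {m : Measure (Time T)} {h : Time T → E} (hh : Integrable h m) {t s : Time T} (hts : t ≤ s) :
    ∫ r in Ioi t, h r ∂m - ∫ r in Ioi s, h r ∂m = ∫ r in Ioc t s, h r ∂m := by
  rw [← Ioc_union_Ioi_eq_Ioi hts, setIntegral_union _ measurableSet_Ioi hh.integrableOn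
    hh.integrableOn, add_sub_cancel_right]
  exact disjoint_left.2 fun r h1 h2 => not_lt.2 h1.2 h2

/-- With its left counterpart, this says that the set of jumps still to come is locally constant on
each side of t; only on the left does it contain a jump at t itself. -/
theorem eventually_nhdsGE_lt_iff {ι : Type*} (I : Finset ι) (τ : ι → Time T) (t : Time T) :
    ∀ᶠ s in 𝓝[≥] t, ∀ i ∈ I, (s < τ i ↔ t < τ i) := by
  rw [eventually_all_finset]
  intro i _
  rcases lt_or_ge t (τ i) with h | h
  · filter_upwards [mem_nhdsWithin_of_mem_nhds (Iio_mem_nhds h)] with s hs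
    simpa [h] using hs
  · filter_upwards [self_mem_nhdsWithin] with s hs
    simp [not_lt.2 h, not_lt.2 (h.trans hs)]

theorem eventually_nhdsLT_lt_iff {ι : Type*} (I : Finset ι) (τ : ι → Time T) (t : Time T) :
    ∀ᶠ s in 𝓝[<] t, ∀ i ∈ I, (s < τ i ↔ t ≤ τ i) := by
  rw [eventually_all_finset]
  intro i _
  rcases lt_or_ge (τ i) t with h | h
  · filter_upwards [mem_nhdsWithin_of_mem_nhds (Ioi_mem_nhds h)] with s hs
    simp [not_le.2 h, not_lt.2 (le_of_lt (mem_Ioi.1 hs))]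
  · filter_upwards [self_mem_nhdsWithin] with s hs
    simp [h, lt_of_lt_of_le hs h]

open Classical in
theorem sum_filter_le_eq_add {ι X : Type*} [AddCommMonoid X] (I : Finset ι) (τ : ι → Time T)
    (z : ι → X) (t : Time T) :
    ∑ i ∈ I with t ≤ τ i, z i = ∑ i ∈ I with t < τ i, z i + ∑ i ∈ I with τ i = t, z i := by
  rw [← Finset.sum_union]
  · congr 1
    ext i
    simp only [Finset.mem_filter, Finset.mem_union, le_iff_lt_or_eq]
    grind
  · exact Finset.disjoint_filter.2 fun i _ h1 h2 => h1.ne' h2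

section ChainRule

variable {E : Type*} [NormedAddCommGroup E] [NormedSpace ℝ E] [CompleteSpace E]

/-- First-order expansion of `F ∘ u` to the right of `t`, for `u` with density `G`. -/
theorem eventually_abs_increment_sub_le {m : Measure (Time T)} {F : E → ℝ} (hF : ContDiff ℝ 1 F)
    {G : Time T → E} (hG : Integrable G m) {u : Time T → E} {t : Time T}
    (hu : ContinuousWithinAt u (Ici t) t)
    (hinc : ∀ᶠ s in 𝓝[>] t, u s - u t = ∫ r in Ioc t s, G r ∂m)
    (hderiv : Integrable (fun r => fderiv ℝ F (u r) (G r)) m) {η : ℝ} (hη : 0 < η) :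
    ∀ᶠ s in 𝓝[>] t, |F (u s) - F (u t) - ∫ r in Ioc t s, fderiv ℝ F (u r) (G r) ∂m| ≤
      η * ∫ r in Ioc t s, ‖G r‖ ∂m := by
  have hu' : Tendsto u (𝓝[>] t) (𝓝 (u t)) := hu.mono Ioi_subset_Ici_self
  -- Half of η pays for the Taylor remainder at `u t`, the other half for replacing the derivative
  -- at `u t` by the derivative at `u r`.
  have h1 := hu'.eventually
    (((hF.differentiable one_ne_zero (u t)).hasFDerivAt.isLittleO).def (half_pos hη))
  have h2 : ∀ᶠ s in 𝓝[≥] t, ‖fderiv ℝ F (u s) - fderiv ℝ F (u t)‖ < η / 2 := by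
    have hc := (hF.continuous_fderiv one_ne_zero).continuousAt.comp_continuousWithinAt hu
    simpa [dist_eq_norm] using Metric.tendsto_nhds.1 hc _ (half_pos hη)
  have h3 : ∀ᶠ s in 𝓝[>] t, ∀ r ∈ Ioc t s, ‖fderiv ℝ F (u r) - fderiv ℝ F (u t)‖ ≤ η / 2 := by
    rcases eq_or_ne t ⊤ with rfl | ht
    · filter_upwards [self_mem_nhdsWithin] with s hs using absurd (mem_Ioi.1 hs) not_top_lt
    obtain ⟨b, hb, hbV⟩ := (mem_nhdsGE_iff_exists_Ico_subset' (lt_top_iff_ne_top.2 ht)).1 h2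
    filter_upwards [Ioo_mem_nhdsGT hb] with s hs r hr
    exact (hbV ⟨hr.1.le, hr.2.trans_lt hs.2⟩).le
  filter_upwards [h1, h3, hinc] with s h1 h3 hinc
  have hGs : IntegrableOn G (Ioc t s) m := hG.integrableOn
  have e1 : fderiv ℝ F (u t) (u s - u t) = ∫ r in Ioc t s, fderiv ℝ F (u t) (G r) ∂m := by
    rw [hinc, ContinuousLinearMap.integral_comp_comm _ hGs]
  have e2 : ‖u s - u t‖ ≤ ∫ r in Ioc t s, ‖G r‖ ∂m := by
    rw [hinc]; exact norm_integral_le_integral_norm _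
  have e3 : |∫ r in Ioc t s, fderiv ℝ F (u t) (G r) ∂m -
      ∫ r in Ioc t s, fderiv ℝ F (u r) (G r) ∂m| ≤ η / 2 * ∫ r in Ioc t s, ‖G r‖ ∂m := by
    rw [← integral_sub ((fderiv ℝ F (u t)).integrable_comp hGs) hderiv.integrableOn,
      ← integral_const_mul, ← Real.norm_eq_abs]
    refine norm_integral_le_of_norm_le (hGs.norm.const_mul _) ?_
    refine (ae_restrict_iff' measurableSet_Ioc).2 (Eventually.of_forall fun r hr => ?_)
    rw [← sub_apply]
    refine (ContinuousLinearMap.le_opNorm _ _).trans ?_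
    gcongr
    rw [norm_sub_rev]
    exact h3 r hr
  rw [Real.norm_eq_abs, e1] at h1
  have h4 : η / 2 * ‖u s - u t‖ ≤ η / 2 * ∫ r in Ioc t s, ‖G r‖ ∂m := by gcongr
  calc _ = |(F (u s) - F (u t) - ∫ r in Ioc t s, fderiv ℝ F (u t) (G r) ∂m) +
        (∫ r in Ioc t s, fderiv ℝ F (u t) (G r) ∂m -
          ∫ r in Ioc t s, fderiv ℝ F (u r) (G r) ∂m)| := by congr 1; ring
    _ ≤ _ := (abs_add_le _ _).trans (by linarith)

open Classical in
/-- Change of variables for a piecewise absolutely continuous path with finitely many jumps. -/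
theorem comp_eq_of_jumps {ι : Type*} {m : Measure (Time T)} [NullSingletonClass m] {F : E → ℝ}
    (hF : ContDiff ℝ 1 F) {G : Time T → E} (hG : Integrable G m) {u : Time T → E}
    {I : Finset ι} {τ : ι → Time T} (hτ : InjOn τ I) {ζ : ι → E} {x₀ : E}
    (hu : ∀ t, u t = x₀ - ∑ i ∈ I with t < τ i, ζ i - ∫ r in Ioi t, G r ∂m)
    (hderiv : Integrable (fun r => fderiv ℝ F (u r) (G r)) m) (t : Time T) :
    F (u t) + ∑ i ∈ I with t < τ i, (F (u (τ i)) - F (u (τ i) - ζ i)) +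
      ∫ r in Ioi t, fderiv ℝ F (u r) (G r) ∂m = F x₀ := by
  -- `D` will be shown to be continuous with negligible right increments, hence constant; at ⊤ it
  -- equals F x₀.
  set D : Time T → ℝ := fun t => F (u t) + ∑ i ∈ I with t < τ i, (F (u (τ i)) - F (u (τ i) - ζ i)) +
      ∫ r in Ioi t, fderiv ℝ F (u r) (G r) ∂m with hDdef
  have hGc := continuous_setIntegral_Ioi hG
  have hhc := continuous_setIntegral_Ioi hderiv
  have hur : ∀ t, ContinuousWithinAt u (Ici t) t := by
    intro t
    refine ContinuousWithinAt.congr_of_eventuallyEq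
      (f := fun s => x₀ - ∑ i ∈ I with t < τ i, ζ i - ∫ r in Ioi s, G r ∂m)
      (continuousWithinAt_const.sub hGc.continuousWithinAt) ?_ (hu t)
    filter_upwards [eventually_nhdsGE_lt_iff I τ t] with s hs
    rw [hu s, Finset.filter_congr hs]
  have hF' := hF.continuous
  have hDr : ∀ t, ContinuousWithinAt D (Ici t) t := by
    intro t
    have h1 : ContinuousWithinAt (fun s => F (u s) +
        ∑ i ∈ I with t < τ i, (F (u (τ i)) - F (u (τ i) - ζ i)) +
        ∫ r in Ioi s, fderiv ℝ F (u r) (G r) ∂m) (Ici t) t :=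
      ((hF'.continuousAt.comp_continuousWithinAt (hur t)).add continuousWithinAt_const).add
        hhc.continuousWithinAt
    refine h1.congr_of_eventuallyEq ?_ rfl
    filter_upwards [eventually_nhdsGE_lt_iff I τ t] with s hs
    simp only [hDdef, Finset.filter_congr hs]
  -- To the left of t the path is `v`, which has not yet made the jump at t. The change of F from `v
  -- t` to `u t` is exactly the summand of `D` at t, so the two discontinuities cancel.
  have hDl : ∀ t, ContinuousWithinAt D (Iio t) t := by
    intro t
    set v : Time T → E := fun s => x₀ - ∑ i ∈ I with t ≤ τ i, ζ i - ∫ r in Ioi s, G r ∂m with hv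
    have hvc : Continuous v := by fun_prop
    have h1 : ContinuousWithinAt (fun s => F (v s) +
        ∑ i ∈ I with t ≤ τ i, (F (u (τ i)) - F (u (τ i) - ζ i)) +
        ∫ r in Ioi s, fderiv ℝ F (u r) (G r) ∂m) (Iio t) t := by
      fun_prop
    refine h1.congr_of_eventuallyEq ?_ ?_
    · filter_upwards [eventually_nhdsLT_lt_iff I τ t] with s hs
      simp only [hDdef, hu s, Finset.filter_congr hs, hv]
    · simp only [hDdef]
      rw [sum_filter_le_eq_add]
      have hvt : v t = u t - ∑ i ∈ I with τ i = t, ζ i := by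
        rw [hv, hu t]; simp only; rw [sum_filter_le_eq_add]; abel
      rw [hvt]
      by_cases hex : ∃ j ∈ I, τ j = t
      · obtain ⟨j, hj, rfl⟩ := hex
        have : ({i ∈ I | τ i = τ j} : Finset ι) = {j} := by
          ext i
          simp only [Finset.mem_filter, Finset.mem_singleton]
          exact ⟨fun h => hτ h.1 hj h.2, fun h => by rw [h]; exact ⟨hj, rfl⟩⟩
        rw [this, Finset.sum_singleton, Finset.sum_singleton]; ring
      · have : ({i ∈ I | τ i = t} : Finset ι) = ∅ := by
          ext i; simp only [Finset.mem_filter]; grind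
        rw [this]; simp
  have hD : Continuous D := continuous_iff_continuousAt.2 fun t =>
    continuousAt_iff_continuous_left'_right'.2
      ⟨hDl t, (hDr t).mono Ioi_subset_Ici_self⟩
  have := eq_of_forall_increment_le (M := fun t => - ∫ r in Ioi t, ‖G r‖ ∂m) hD
    (continuous_setIntegral_Ioi hG.norm).neg (fun t _ η hη => ?_) t
  · rw [hDdef] at this
    simp only at this
    rw [this, hu ⊤]
    simp
  · have hnhd : ∀ᶠ s in 𝓝[>] t, ∀ i ∈ I, (s < τ i ↔ t < τ i) :=
      (eventually_nhdsGE_lt_iff I τ t).filter_mono (nhdsWithin_mono _ Ioi_subset_Ici_self)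
    filter_upwards [hnhd, self_mem_nhdsWithin, eventually_abs_increment_sub_le hF hG (hur t)
      (by
        filter_upwards [hnhd, self_mem_nhdsWithin] with s hs hts
        rw [hu s, hu t, Finset.filter_congr hs, ← setIntegral_Ioi_sub hG (le_of_lt hts)]
        abel) hderiv hη] with s hs hts hle
    rw [← setIntegral_Ioi_sub hderiv (le_of_lt hts),
      ← setIntegral_Ioi_sub hG.norm (le_of_lt hts)] at hle
    simp only [hDdef, Finset.filter_congr hs]
    convert hle using 2
    · ring
    · ring

end ChainRule

end BSDE

/-! ### The chain rule for |y|^p e^{βa}. -/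

namespace BSDE

variable {T : ℝ≥0}

section ChainRule

variable {E : Type*} [NormedAddCommGroup E] [NormedSpace ℝ E]

open Classical in
/-- Along a path with finitely many jumps, continuous functions are bounded and measurable. -/
theorem integrable_continuous_comp_mul {ι : Type*} [ProperSpace E] [SecondCountableTopology E]
    {m : Measure (Time T)} [NullSingletonClass m] {G : Time T → E}
    (hG : Integrable G m) {u : Time T → E}
    {I : Finset ι} {τ : ι → Time T} {ζ : ι → E} {x₀ : E}
    (hu : ∀ t, u t = x₀ - ∑ i ∈ I with t < τ i, ζ i - ∫ r in Ioi t, G r ∂m)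
    {k : E → ℝ} (hk : Continuous k) {h : Time T → ℝ} (hh : Integrable h m) :
    Integrable (fun r => k (u r) * h r) m := by
  borelize E
  have hmeas : Measurable u := by
    have : u = fun t => x₀ - ∑ i ∈ I, (if t < τ i then ζ i else 0) - ∫ r in Ioi t, G r ∂m := by
      funext t; rw [hu t, Finset.sum_filter]
    rw [this]
    refine (measurable_const.sub (Finset.measurable_sum _ fun i _ => ?_)).sub
      (continuous_setIntegral_Ioi hG).measurable
    exact Measurable.ite measurableSet_Iio measurable_const measurable_const
  have hbdd : ∀ t, u t ∈ Metric.closedBall (0 : E)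
      (‖x₀‖ + ∑ i ∈ I, ‖ζ i‖ + ∫ r, ‖G r‖ ∂m) := by
    intro t
    rw [mem_closedBall_zero_iff, hu t]
    refine (norm_sub_le _ _).trans (add_le_add ((norm_sub_le _ _).trans (add_le_add_right ?_ _)) ?_)
    · refine (norm_sum_le _ _).trans ?_
      exact Finset.sum_le_sum_of_subset_of_nonneg (Finset.filter_subset _ _)
        fun _ _ _ => norm_nonneg _
    · refine (norm_integral_le_integral_norm _).trans ?_
      exact setIntegral_le_integral hG.norm (Eventually.of_forall fun _ => norm_nonneg _)
  obtain ⟨C, hC⟩ := (isCompact_closedBall (0 : E) (‖x₀‖ + ∑ i ∈ I, ‖ζ i‖ + ∫ r, ‖G r‖ ∂m)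
    ).exists_bound_of_continuousOn hk.continuousOn
  exact hh.bdd_mul (hk.measurable.comp hmeas).aestronglyMeasurable
    (Eventually.of_forall fun r => hC _ (hbdd r))

end ChainRule

section Path

theorem hasFDerivAt_rpow_abs_mul_exp {p : ℝ} (hp : 1 < p) (β : ℝ) (x : ℝ × ℝ) :
    HasFDerivAt (fun q : ℝ × ℝ => |q.1| ^ p * Real.exp (β * q.2))
      ((|x.1| ^ p) • (Real.exp (β * x.2) • (β • ContinuousLinearMap.snd ℝ ℝ ℝ)) +
        Real.exp (β * x.2) • ((p * |x.1| ^ (p - 2) * x.1) • ContinuousLinearMap.fst ℝ ℝ ℝ)) x := by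
  have h1 := (hasDerivAt_abs_rpow x.1 hp).comp_hasFDerivAt x
    (hasFDerivAt_fst (𝕜 := ℝ) (E := ℝ) (F := ℝ) (p := x))
  have h2 := ((hasFDerivAt_snd (𝕜 := ℝ) (E := ℝ) (F := ℝ) (p := x)).const_mul β).exp
  exact h1.mul h2

theorem contDiff_rpow_abs_mul_exp {p : ℝ} (hp : 1 < p) (β : ℝ) :
    ContDiff ℝ 1 (fun q : ℝ × ℝ => |q.1| ^ p * Real.exp (β * q.2)) := by
  have h1 : ContDiff ℝ 1 (fun x : ℝ => |x| ^ p) := by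
    simpa [Real.norm_eq_abs] using contDiff_norm_rpow (E := ℝ) hp
  exact (h1.comp contDiff_fst).mul (by fun_prop)

/-- For p < 2 the factor |x|^(p-2) is singular at 0; continuity comes from recognising the
derivative of the C¹ function |x|^p. -/
theorem continuous_rpow_abs_sub_two_mul {p : ℝ} (hp : 1 < p) :
    Continuous fun x : ℝ => p * |x| ^ (p - 2) * x := by
  have h1 : ContDiff ℝ 1 (fun x : ℝ => |x| ^ p) := by
    simpa [Real.norm_eq_abs] using contDiff_norm_rpow (E := ℝ) hp
  have h2 : deriv (fun x : ℝ => |x| ^ p) = fun x => p * |x| ^ (p - 2) * x :=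
    funext fun x => (hasDerivAt_abs_rpow x hp).deriv
  exact h2 ▸ h1.continuous_deriv le_rfl

theorem abs_rpow_abs_sub_two_mul {p : ℝ} (hp : 1 < p) (x : ℝ) :
    |p * |x| ^ (p - 2) * x| = p * |x| ^ (p - 1) := by
  rcases eq_or_ne x 0 with rfl | hx
  · simp [Real.zero_rpow (sub_ne_zero.2 hp.ne')]
  · have : |x| ^ (p - 1) = |x| ^ (p - 2) * |x| := by
      rw [← Real.rpow_add_one (abs_ne_zero.2 hx)]; ring_nf
    rw [this, abs_mul, abs_mul, abs_of_pos (by linarith : 0 < p),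
      abs_of_nonneg (Real.rpow_nonneg (abs_nonneg x) _), mul_assoc]

variable {ι : Type*} {m : Measure (Time T)} [NullSingletonClass m]
  {I : Finset ι} {τ : ι → Time T} {z : ι → ℝ} {g y a : Time T → ℝ} {ξ p β : ℝ}

-- Just before t the equation also counts a jump at t. The time ⊥ is excluded because the left limit
-- there is the value itself by convention.
open Classical in
theorem leftLim_eq_sub_sum (hg : Integrable g m)
    (hy : ∀ t, y t + ∑ i ∈ I with t < τ i, z i = ξ + ∫ r in Ioi t, g r ∂m) {t : Time T}
    (ht : ⊥ < t) : Function.leftLim y t = y t - ∑ i ∈ I with τ i = t, z i := by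
  have : (𝓝[<] t).NeBot := nhdsLT_neBot_of_exists_lt ⟨⊥, ht⟩
  refine leftLim_eq_of_tendsto ?_
  have hc := continuous_setIntegral_Ioi hg
  have h1 : Tendsto (fun s => ξ + ∫ r in Ioi s, g r ∂m - ∑ i ∈ I with t ≤ τ i, z i) (𝓝[<] t)
      (𝓝 (ξ + ∫ r in Ioi t, g r ∂m - ∑ i ∈ I with t ≤ τ i, z i)) :=
    ((continuous_const.add hc).sub continuous_const).continuousAt.continuousWithinAt
  have h2 : ξ + ∫ r in Ioi t, g r ∂m - ∑ i ∈ I with t ≤ τ i, z i =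
      y t - ∑ i ∈ I with τ i = t, z i := by
    rw [sum_filter_le_eq_add, ← hy t]; ring
  rw [← h2]
  refine h1.congr' ?_
  filter_upwards [eventually_nhdsLT_lt_iff I τ t] with s hs
  rw [← hy s, Finset.filter_congr hs]; ring

open Classical in
theorem leftLim_jump_time (hg : Integrable g m) (hτ : InjOn τ I)
    (hy : ∀ t, y t + ∑ i ∈ I with t < τ i, z i = ξ + ∫ r in Ioi t, g r ∂m) {i : ι}
    (hi : i ∈ I) (ht : ⊥ < τ i) : Function.leftLim y (τ i) = y (τ i) - z i := by
  rw [leftLim_eq_sub_sum hg hy ht]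
  have : ({j ∈ I | τ j = τ i} : Finset ι) = {i} := by
    ext j
    simp only [Finset.mem_filter, Finset.mem_singleton]
    exact ⟨fun h => hτ h.1 hi h.2, fun h => by rw [h]; exact ⟨hi, rfl⟩⟩
  rw [this, Finset.sum_singleton]

-- Jump times and ⊥ form a finite set, which a measure without atoms does not see. This lets the
-- predictable version y_- replace y in dA-integrals.
open Classical in
theorem ae_leftLim_eq (hg : Integrable g m)
    (hy : ∀ t, y t + ∑ i ∈ I with t < τ i, z i = ξ + ∫ r in Ioi t, g r ∂m) :
    ∀ᵐ t ∂m, Function.leftLim y t = y t := by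
  have h1 : ∀ᵐ t ∂m, t ∉ τ '' I :=
    measure_eq_zero_iff_ae_notMem.1 ((I.finite_toSet.image τ).measure_zero m)
  have h2 : ∀ᵐ t ∂m, t ≠ ⊥ := by simp [ae_iff]
  filter_upwards [h1, h2] with t h1 h2
  rw [leftLim_eq_sub_sum hg hy (bot_lt_iff_ne_bot.2 h2), Finset.sum_eq_zero, sub_zero]
  intro i hi
  rw [Finset.mem_filter] at hi
  exact absurd ⟨i, hi.1, hi.2⟩ h1

open Classical in
/-- The change of variables formula for `|y| ^ p * exp (β a)`. -/
theorem rpow_abs_mul_exp_eq [IsFiniteMeasure m] (hp : 1 < p) (hg : Integrable g m) (hτ : InjOn τ I)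
    (ha : ∀ t, a t = a ⊤ - m.real (Ioi t))
    (hy : ∀ t, y t + ∑ i ∈ I with t < τ i, z i = ξ + ∫ r in Ioi t, g r ∂m) (t : Time T) :
    (Integrable (fun r => |y r| ^ p * Real.exp (β * a r)) m ∧
    Integrable (fun r => p * |y r| ^ (p - 2) * y r * Real.exp (β * a r) * g r) m) ∧
    |y t| ^ p * Real.exp (β * a t) + β * ∫ r in Ioi t, |y r| ^ p * Real.exp (β * a r) ∂m +
      ∑ i ∈ I with t < τ i, (|y (τ i)| ^ p * Real.exp (β * a (τ i)) -
        |y (τ i) - z i| ^ p * Real.exp (β * a (τ i))) =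
      |ξ| ^ p * Real.exp (β * a ⊤) +
        ∫ r in Ioi t, p * |y r| ^ (p - 2) * y r * Real.exp (β * a r) * g r ∂m := by
  have h1 : Integrable (fun _ : Time T => (1 : ℝ)) m := integrable_const _
  have hG : Integrable (fun r => ((- g r, 1) : ℝ × ℝ)) m := hg.neg.prodMk h1
  -- The pair (y, a) is a planar path with density (-g, 1) and jumps (z i, 0), since `a` is
  -- continuous.
  have hu : ∀ t, ((y t, a t) : ℝ × ℝ) = (ξ, a ⊤) - ∑ i ∈ I with t < τ i, ((z i, 0) : ℝ × ℝ) -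
      ∫ r in Ioi t, ((- g r, 1) : ℝ × ℝ) ∂m := by
    intro t
    have hg' : IntegrableOn (fun r => - g r) (Ioi t) m := hg.neg.integrableOn
    rw [integral_pair hg' h1.integrableOn]
    ext
    · simp only [Prod.fst_sub, Prod.fst_sum, integral_neg]
      linarith [hy t]
    · simp only [Prod.snd_sub, Prod.snd_sum, Finset.sum_const_zero]
      rw [ha t]; simp
  have hF := contDiff_rpow_abs_mul_exp hp β
  have i1 : Integrable (fun r => |y r| ^ p * Real.exp (β * a r)) m := by
    simpa using integrable_continuous_comp_mul hG hu hF.continuous h1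
  have i2 : Integrable (fun r => p * |y r| ^ (p - 2) * y r * Real.exp (β * a r) * g r) m :=
    integrable_continuous_comp_mul hG hu
      (k := fun q => p * |q.1| ^ (p - 2) * q.1 * Real.exp (β * q.2))
      (((continuous_rpow_abs_sub_two_mul hp).comp continuous_fst).mul (by fun_prop)) hg
  refine ⟨⟨i1, i2⟩, ?_⟩
  have hder : ∀ r, fderiv ℝ (fun q : ℝ × ℝ => |q.1| ^ p * Real.exp (β * q.2)) (y r, a r)
      (- g r, 1) = β * (|y r| ^ p * Real.exp (β * a r)) -
        p * |y r| ^ (p - 2) * y r * Real.exp (β * a r) * g r := by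
    intro r
    rw [(hasFDerivAt_rpow_abs_mul_exp hp β (y r, a r)).fderiv]
    simp
    ring
  have key := comp_eq_of_jumps hF hG hτ hu (by
    simp_rw [hder]; exact (i1.const_mul β).sub i2) t
  simp_rw [hder] at key
  rw [integral_sub (i1.const_mul β).integrableOn i2.integrableOn, integral_const_mul] at key
  simp only [Prod.mk_sub_mk, sub_zero] at key
  linarith

-- The identity is weakened to terms that are all nonnegative: the jump sums sit on opposite sides
-- and g becomes |g|. Expectations can then be taken in [0, ∞], and writing the jump sums with left
-- limits makes their integrands predictable.
open Classical in
theorem ofReal_rpow_abs_mul_exp_le [IsFiniteMeasure m] (hp : 1 < p) (hβ : 0 ≤ β)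
    (hg : Integrable g m) (hτ : InjOn τ I)
    (hτ0 : ∀ i ∈ I, ⊥ < τ i) (ha : ∀ t, a t = a ⊤ - m.real (Ioi t))
    (hy : ∀ t, y t + ∑ i ∈ I with t < τ i, z i = ξ + ∫ r in Ioi t, g r ∂m) (t : Time T) :
    ENNReal.ofReal (|y t| ^ p * Real.exp (β * a t)) +
      ENNReal.ofReal β * ∫⁻ r in Ioi t,
        ENNReal.ofReal (|Function.leftLim y r| ^ p * Real.exp (β * a r)) ∂m +
      ∑ i ∈ I with t < τ i,
        ENNReal.ofReal (|Function.leftLim y (τ i) + z i| ^ p * Real.exp (β * a (τ i))) ≤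
    ENNReal.ofReal (|ξ| ^ p * Real.exp (β * a ⊤)) +
      ∫⁻ r in Ioi t, ENNReal.ofReal
        (p * |Function.leftLim y r| ^ (p - 1) * Real.exp (β * a r) * |g r|) ∂m +
      ∑ i ∈ I with t < τ i,
        ENNReal.ofReal (|Function.leftLim y (τ i)| ^ p * Real.exp (β * a (τ i))) := by
  obtain ⟨⟨i1, i2⟩, key⟩ := rpow_abs_mul_exp_eq (β := β) hp hg hτ ha hy t
  have hae := ae_leftLim_eq hg hy
  have e1 : ∫⁻ r in Ioi t, ENNReal.ofReal (|Function.leftLim y r| ^ p * Real.exp (β * a r)) ∂m =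
      ENNReal.ofReal (∫ r in Ioi t, |y r| ^ p * Real.exp (β * a r) ∂m) := by
    rw [ofReal_integral_eq_lintegral_ofReal i1.integrableOn
      (Eventually.of_forall fun r => by positivity)]
    refine lintegral_congr_ae (ae_restrict_of_ae ?_)
    filter_upwards [hae] with r hr
    rw [hr]
  have hnorm : ∀ r, |p * |y r| ^ (p - 2) * y r * Real.exp (β * a r) * g r| =
      p * |y r| ^ (p - 1) * Real.exp (β * a r) * |g r| := fun r => by
    rw [abs_mul, abs_mul, abs_rpow_abs_sub_two_mul hp, Real.abs_exp]
  have e2 : ∫⁻ r in Ioi t, ENNReal.ofReal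
        (p * |Function.leftLim y r| ^ (p - 1) * Real.exp (β * a r) * |g r|) ∂m =
      ENNReal.ofReal (∫ r in Ioi t, |p * |y r| ^ (p - 2) * y r * Real.exp (β * a r) * g r| ∂m) := by
    rw [ofReal_integral_eq_lintegral_ofReal i2.abs.integrableOn
      (Eventually.of_forall fun r => abs_nonneg _)]
    refine lintegral_congr_ae (ae_restrict_of_ae ?_)
    filter_upwards [hae] with r hr
    rw [hr, hnorm]
  have e3 : ∑ i ∈ I with t < τ i,
        ENNReal.ofReal (|Function.leftLim y (τ i) + z i| ^ p * Real.exp (β * a (τ i))) =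
      ENNReal.ofReal (∑ i ∈ I with t < τ i, |y (τ i)| ^ p * Real.exp (β * a (τ i))) := by
    rw [ENNReal.ofReal_sum_of_nonneg fun i _ => by positivity]
    refine Finset.sum_congr rfl fun i hi => ?_
    have hi := (Finset.mem_filter.1 hi).1
    rw [leftLim_jump_time hg hτ hy hi (hτ0 i hi), sub_add_cancel]
  have e4 : ∑ i ∈ I with t < τ i,
        ENNReal.ofReal (|Function.leftLim y (τ i)| ^ p * Real.exp (β * a (τ i))) =
      ENNReal.ofReal (∑ i ∈ I with t < τ i, |y (τ i) - z i| ^ p * Real.exp (β * a (τ i))) := by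
    rw [ENNReal.ofReal_sum_of_nonneg fun i _ => by positivity]
    refine Finset.sum_congr rfl fun i hi => ?_
    have hi := (Finset.mem_filter.1 hi).1
    rw [leftLim_jump_time hg hτ hy hi (hτ0 i hi)]
  have n1 : 0 ≤ ∫ r in Ioi t, |y r| ^ p * Real.exp (β * a r) ∂m :=
    integral_nonneg fun r => by positivity
  have n2 : 0 ≤ ∫ r in Ioi t, |p * |y r| ^ (p - 2) * y r * Real.exp (β * a r) * g r| ∂m :=
    integral_nonneg fun r => abs_nonneg _
  have n3 : 0 ≤ ∑ i ∈ I with t < τ i, |y (τ i)| ^ p * Real.exp (β * a (τ i)) :=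
    Finset.sum_nonneg fun i _ => by positivity
  have n4 : 0 ≤ ∑ i ∈ I with t < τ i, |y (τ i) - z i| ^ p * Real.exp (β * a (τ i)) :=
    Finset.sum_nonneg fun i _ => by positivity
  rw [e1, e2, e3, e4, ← ENNReal.ofReal_mul hβ, ← ENNReal.ofReal_add (by positivity) (by positivity),
    ← ENNReal.ofReal_add (by positivity) n3, ← ENNReal.ofReal_add (by positivity) n2,
    ← ENNReal.ofReal_add (by positivity) n4]
  refine ENNReal.ofReal_le_ofReal ?_
  rw [Finset.sum_sub_distrib] at key
  have : ∫ r in Ioi t, p * |y r| ^ (p - 2) * y r * Real.exp (β * a r) * g r ∂m ≤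
      ∫ r in Ioi t, |p * |y r| ^ (p - 2) * y r * Real.exp (β * a r) * g r| ∂m :=
    integral_mono i2.integrableOn i2.abs.integrableOn fun r => le_abs_self _
  linarith

end Path

end BSDE

/-! ### Measurability: predictable left limits and random Stieltjes measures. -/

namespace BSDE

variable {T : ℝ≥0}

section LeftLim

/-- The point `k / 2 ^ n` of `[0, T]`, truncated at `T`. -/
noncomputable def dyadicTime (T : ℝ≥0) (n k : ℕ) : Time T :=
  ⟨min T (k / 2 ^ n), mem_Iic.2 (min_le_left _ _)⟩

theorem dyadicTime_zero (n : ℕ) : dyadicTime T n 0 = ⊥ := by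
  ext; simp [dyadicTime]

theorem dyadicTime_lt_iff (n k : ℕ) (t : Time T) :
    dyadicTime T n k < t ↔ (k : ℝ≥0) < t * 2 ^ n := by
  rw [← Subtype.coe_lt_coe, dyadicTime, min_lt_iff, div_lt_iff₀ (by positivity)]
  simp only [or_iff_right_iff_imp]
  exact fun h => absurd (mem_Iic.1 t.2) (not_le.2 h)

/-- The ceiling minus one indexes the half-open dyadic cell containing t. Truncated subtraction
sends t = ⊥ to cell 0 although ⊥ lies in no cell, hence the extra alternative. -/
theorem ceil_sub_one_eq_iff (n k : ℕ) (t : Time T) : ⌈(t : ℝ≥0) * 2 ^ n⌉₊ - 1 = k ↔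
    t ∈ Ioc (dyadicTime T n k) (dyadicTime T n (k + 1)) ∨ (k = 0 ∧ t = ⊥) := by
  rw [mem_Ioc, dyadicTime_lt_iff, ← not_lt, dyadicTime_lt_iff, not_lt]
  rcases eq_or_ne t ⊥ with rfl | ht
  · have h0 : (((⊥ : Time T) : ℝ≥0)) = 0 := rfl
    simp [h0, eq_comm]
  · have hpos : (0 : ℝ≥0) < t * 2 ^ n := by
      have : (⊥ : Time T) < t := bot_lt_iff_ne_bot.2 ht
      have : (0 : ℝ≥0) < t := this
      positivity
    rw [← Nat.ceil_le, ← Nat.lt_ceil]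
    have := Nat.ceil_pos.2 hpos
    simp only [ht, and_false, or_false]
    omega

variable {Ω : Type*} {mΩ : MeasurableSpace Ω}

/-- The left limit at t is the limit of Y at the last dyadic time strictly before t. On each cell
that approximation equals Y at the left endpoint, which makes it predictable; ⊥ is treated
separately. -/
theorem measurable_leftLim_predictable (F : Filtration (Time T) mΩ) {Y : Time T → Ω → ℝ}
    (hY : Adapted F Y) (hl : ∀ ω t, ∃ l, Tendsto (fun s => Y s ω) (𝓝[<] t) (𝓝 l)) :
    Measurable[F.predictable] fun q : Time T × Ω => Function.leftLim (fun s => Y s q.2) q.1 := by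
  refine @measurable_of_tendsto_metrizable _ _ F.predictable _ _ _ _
    (fun n q => Y (dyadicTime T n (⌈(q.1 : ℝ≥0) * 2 ^ n⌉₊ - 1)) q.2) _ (fun n => ?_) ?_
  · intro B hB
    have : (fun q : Time T × Ω => Y (dyadicTime T n (⌈(q.1 : ℝ≥0) * 2 ^ n⌉₊ - 1)) q.2) ⁻¹' B =
        (⋃ k : ℕ, Ioc (dyadicTime T n k) (dyadicTime T n (k + 1)) ×ˢ (Y (dyadicTime T n k) ⁻¹' B))
          ∪ {⊥} ×ˢ (Y ⊥ ⁻¹' B) := by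
      ext ⟨t, ω⟩
      simp only [mem_preimage, mem_union, mem_iUnion, mem_prod, mem_singleton_iff]
      constructor
      · intro h
        rcases (ceil_sub_one_eq_iff n _ t).1 rfl with h1 | ⟨h1, h2⟩
        · exact Or.inl ⟨_, h1, h⟩
        · rw [h1, dyadicTime_zero] at h
          exact Or.inr ⟨h2, h⟩
      · rintro (⟨k, h1, h2⟩ | ⟨h1, h2⟩)
        · rwa [(ceil_sub_one_eq_iff n k t).2 (Or.inl h1)]
        · rw [(ceil_sub_one_eq_iff n 0 t).2 (Or.inr ⟨rfl, h1⟩), dyadicTime_zero]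
          exact h2
    rw [this]
    refine MeasurableSet.union (MeasurableSet.iUnion fun k => ?_) ?_
    · exact measurableSet_predictable_Ioc_prod _ _ (hY _ hB)
    · exact measurableSet_predictable_singleton_bot_prod (hY _ hB)
  · rw [tendsto_pi_nhds]
    rintro ⟨t, ω⟩
    simp only
    rcases eq_or_ne t ⊥ with rfl | ht
    · rw [leftLim_eq_of_isBot isBot_bot]
      refine tendsto_const_nhds.congr fun n => ?_
      rw [(ceil_sub_one_eq_iff n 0 ⊥).2 (Or.inr ⟨rfl, rfl⟩), dyadicTime_zero]
    · refine (tendsto_leftLim_of_tendsto (hl ω t)).comp ?_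
      have hmem : ∀ n, t ∈ Ioc (dyadicTime T n (⌈(t : ℝ≥0) * 2 ^ n⌉₊ - 1))
          (dyadicTime T n (⌈(t : ℝ≥0) * 2 ^ n⌉₊ - 1 + 1)) := fun n => by
        rcases (ceil_sub_one_eq_iff n _ t).1 rfl with h1 | ⟨h1, h2⟩
        · exact h1
        · exact absurd h2 ht
      refine tendsto_nhdsWithin_iff.2 ⟨?_, Eventually.of_forall fun n => (hmem n).1⟩
      rw [tendsto_subtype_rng, ← NNReal.tendsto_coe]
      have h2 : Tendsto (fun n : ℕ => ((t : ℝ≥0) : ℝ) - (1 / 2) ^ n) atTop (𝓝 ((t : ℝ≥0) : ℝ)) := by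
        have := tendsto_pow_atTop_nhds_zero_of_lt_one (r := (1 / 2 : ℝ)) (by norm_num) (by norm_num)
        simpa using tendsto_const_nhds.sub this
      refine tendsto_of_tendsto_of_tendsto_of_le_of_le h2 tendsto_const_nhds (fun n => ?_)
        (fun n => ?_)
      · have h3 := (hmem n).2
        set k := ⌈(t : ℝ≥0) * 2 ^ n⌉₊ - 1
        rw [← not_lt, dyadicTime_lt_iff, not_lt] at h3
        have h4 : ((t : ℝ≥0) : ℝ) * 2 ^ n ≤ k + 1 := by exact_mod_cast h3
        have h5 : ((t : ℝ≥0) : ℝ) ≤ T := by exact_mod_cast mem_Iic.1 t.2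
        have h6 : (0 : ℝ) < 2 ^ n := by positivity
        simp only [dyadicTime, NNReal.coe_min, NNReal.coe_div, NNReal.coe_natCast, NNReal.coe_pow,
          NNReal.coe_ofNat]
        refine le_min ?_ ?_
        · have : (0 : ℝ) ≤ (1 / 2) ^ n := by positivity
          linarith
        · rw [le_div_iff₀ h6, sub_mul, ← mul_pow]
          norm_num
          linarith
      · exact_mod_cast (hmem n).1.le

end LeftLim

section Stieltjes

variable {Ω : Type*} [MeasurableSpace Ω]

instance isFiniteMeasure_stieltjes (A : StieltjesFunction (Time T)) : IsFiniteMeasure A.measure :=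
  A.isFiniteMeasure_of_forall_abs_le (C := max |A ⊤| |A ⊥|) fun _ =>
    (abs_le_max_abs_abs (A.mono bot_le) (A.mono le_top)).trans_eq (max_comm _ _)

theorem stieltjes_measure_singleton_bot (A : StieltjesFunction (Time T)) : A.measure {⊥} = 0 := by
  rw [A.measure_singleton, leftLim_eq_of_isBot isBot_bot, sub_self, ENNReal.ofReal_zero]

theorem nullSingletonClass_stieltjes {A : StieltjesFunction (Time T)} (hA : Continuous A) :
    NullSingletonClass A.measure :=
  ⟨fun t => by
    rw [A.measure_singleton, hA.continuousWithinAt.leftLim_eq, sub_self, ENNReal.ofReal_zero]⟩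

theorem stieltjes_eq_sub_real_Ioi (A : StieltjesFunction (Time T)) (t : Time T) :
    A t = A ⊤ - A.measure.real (Ioi t) := by
  rw [← Ioc_top, Measure.real, A.measure_Ioc, ENNReal.toReal_ofReal (sub_nonneg.2 (A.mono le_top))]
  ring

theorem measurable_stieltjes_measure {A : Ω → StieltjesFunction (Time T)}
    (hA : ∀ t, Measurable fun ω => A ω t) : Measurable fun ω => (A ω).measure := by
  have hIic : ∀ t, Measurable fun ω => (A ω).measure (Iic t) := by
    intro t
    have : ∀ ω, (A ω).measure (Iic t) = ENNReal.ofReal (A ω t - A ω ⊥) := by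
      intro ω
      have h : Iic t = Icc ⊥ t := Icc_bot.symm
      rw [h, (A ω).measure_Icc, leftLim_eq_of_isBot isBot_bot]
    simp_rw [this]
    exact ((hA t).sub (hA ⊥)).ennreal_ofReal
  refine Measurable.measure_of_isPiSystem (BorelSpace.measurable_eq.trans
    (borel_eq_generateFrom_Iic (Time T))) isPiSystem_Iic ?_ ?_
  · rintro _ ⟨t, rfl⟩
    exact hIic t
  · have h : (univ : Set (Time T)) = Iic ⊤ := Iic_top.symm
    rw [h]
    exact hIic ⊤

/-- The integrand depends on ω as well. Pushing the measure forward to pairs (t, ω) moves all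
dependence on ω into the measure, whose measurability is checked on rectangles. -/
theorem measurable_lintegral_stieltjes {A : Ω → StieltjesFunction (Time T)}
    (hA : ∀ t, Measurable fun ω => A ω t) {h : Time T × Ω → ℝ≥0∞} (hh : Measurable h) :
    Measurable fun ω => ∫⁻ t, h (t, ω) ∂(A ω).measure := by
  have hm := measurable_stieltjes_measure hA
  have hmap : Measurable fun ω => (A ω).measure.map fun t => (t, ω) := by
    have happ : ∀ (s : Set (Time T)) (B : Set Ω), MeasurableSet s → MeasurableSet B →
        Measurable fun ω => (A ω).measure.map (fun t => (t, ω)) (s ×ˢ B) := by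
      intro s B hs hB
      have : ∀ ω, (A ω).measure.map (fun t => (t, ω)) (s ×ˢ B) =
          B.indicator (fun ω => (A ω).measure s) ω := by
        intro ω
        rw [Measure.map_apply measurable_prodMk_right (hs.prod hB)]
        by_cases hω : ω ∈ B
        · rw [indicator_of_mem hω]; congr 1; ext t; simp [hω]
        · rw [indicator_of_notMem hω]
          convert measure_empty (μ := (A ω).measure)
          ext t; simp [hω]
      simp_rw [this]
      exact (Measure.measurable_measure.1 hm s hs).indicator hB
    have : ∀ ω, IsFiniteMeasure ((A ω).measure.map fun t => (t, ω)) := fun ω => by infer_instance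
    refine Measurable.measure_of_isPiSystem generateFrom_prod.symm isPiSystem_prod ?_ ?_
    · rintro _ ⟨s, hs, B, hB, rfl⟩
      exact happ s B hs hB
    · rw [← univ_prod_univ]
      exact happ _ _ MeasurableSet.univ MeasurableSet.univ
  have heq : ∀ ω, ∫⁻ t, h (t, ω) ∂(A ω).measure =
      ∫⁻ q, h q ∂((A ω).measure.map fun t => (t, ω)) := fun ω =>
    (lintegral_map hh measurable_prodMk_right).symm
  simp_rw [heq]
  exact (Measure.measurable_lintegral hh).comp hmap

end Stieltjes

end BSDE

/-! ### Scalar inequalities and the bound on the driver. -/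

namespace BSDE

section Inequalities

variable {p : ℝ}

theorem one_div_rpow_lt_one (hp : 1 < p) {ε : ℝ} (hε : 0 < ε) :
    (1 / (1 + ε)) ^ (1 / (p - 1)) < 1 :=
  Real.rpow_lt_one (by positivity) (by rw [div_lt_one (by positivity)]; linarith)
    (by have : 0 < p - 1 := by linarith
        positivity)

theorem Cε_nonneg (hp : 1 < p) {ε : ℝ} (hε : 0 < ε) : 0 ≤ Cε p ε :=
  Real.rpow_nonneg (sub_nonneg.2 (one_div_rpow_lt_one hp hε).le) _

/-- Convexity of x^p, with a + b written as the mean of a/l and b/(1-l) with weights l and 1-l. The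
choice of l gives l^(1-p) = 1+ε, and (1-l)^(1-p) is `Cε` by definition. -/
theorem add_rpow_le (hp : 1 < p) {ε : ℝ} (hε : 0 < ε) {a b : ℝ} (ha : 0 ≤ a) (hb : 0 ≤ b) :
    (a + b) ^ p ≤ (1 + ε) * a ^ p + Cε p ε * b ^ p := by
  have hp1 : 0 < p - 1 := by linarith
  set l : ℝ := (1 / (1 + ε)) ^ (1 / (p - 1)) with hl
  have hl0 : 0 < l := by positivity
  have hl1 : 0 < 1 - l := sub_pos.2 (one_div_rpow_lt_one hp hε)
  have hlp : l ^ (1 - p) = 1 + ε := by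
    rw [hl, ← Real.rpow_mul (by positivity)]
    have : 1 / (p - 1) * (1 - p) = -1 := by field_simp; ring
    rw [this, Real.rpow_neg_one]; simp
  have aux : ∀ r x : ℝ, 0 < r → 0 ≤ x → r * (x / r) ^ p = r ^ (1 - p) * x ^ p := by
    intro r x hr hx
    rw [Real.div_rpow hx hr.le, Real.rpow_sub hr, Real.rpow_one]
    ring
  have key := (convexOn_rpow hp.le).2 (mem_Ici.2 (div_nonneg ha hl0.le))
    (mem_Ici.2 (div_nonneg hb hl1.le)) hl0.le hl1.le (by ring)
  simp only [smul_eq_mul] at key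
  rw [mul_div_cancel₀ _ hl0.ne', mul_div_cancel₀ _ hl1.ne', aux l a hl0 ha, aux _ b hl1 hb, hlp]
    at key
  exact key

theorem rpow_abs_le (hp : 1 < p) {ε : ℝ} (hε : 0 < ε) (y z : ℝ) :
    |z| ^ p ≤ (1 + ε) * |y + z| ^ p + Cε p ε * |y| ^ p := by
  refine le_trans ?_ (add_rpow_le hp hε (abs_nonneg _) (abs_nonneg _))
  refine Real.rpow_le_rpow (abs_nonneg _) ?_ (by linarith)
  calc |z| = |(y + z) - y| := by ring_nf
    _ ≤ _ := abs_sub _ _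

/-- Young's inequality with a parameter. -/
theorem mul_rpow_sub_one_mul_le (hp : 1 < p) {a b c : ℝ} (ha : 0 ≤ a) (hb : 0 ≤ b) (hc : 0 < c) :
    p * a ^ (p - 1) * b ≤ (p - 1) * c * a ^ p + c ^ (1 - p) * b ^ p := by
  have hp1 : 0 < p - 1 := by linarith
  have hp0 : 0 < p := by linarith
  have hconj : (p / (p - 1)).HolderConjugate p := (Real.HolderConjugate.conjExponent hp).symm
  have hr : (0 : ℝ) ≤ c ^ ((p - 1) / p) := by positivity
  -- The powers of c cancel in the product and become the weights c and c^(1-p) after raising to the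
  -- conjugate exponents.
  have h := Real.young_inequality_of_nonneg (a := c ^ ((p - 1) / p) * a ^ (p - 1))
    (b := c ^ (-((p - 1) / p)) * b) (by positivity) (by positivity) hconj
  have e1 : (c ^ ((p - 1) / p) * a ^ (p - 1)) ^ (p / (p - 1)) = c * a ^ p := by
    rw [Real.mul_rpow (by positivity) (by positivity), ← Real.rpow_mul hc.le, ← Real.rpow_mul ha]
    congr 2
    · rw [show (p - 1) / p * (p / (p - 1)) = 1 by field_simp, Real.rpow_one]
    · field_simp
  have e2 : (c ^ (-((p - 1) / p)) * b) ^ p = c ^ (1 - p) * b ^ p := by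
    rw [Real.mul_rpow (by positivity) hb, ← Real.rpow_mul hc.le]
    congr 2
    field_simp; ring
  have e3 : c ^ ((p - 1) / p) * a ^ (p - 1) * (c ^ (-((p - 1) / p)) * b) = a ^ (p - 1) * b := by
    rw [Real.rpow_neg hc.le]
    have : c ^ ((p - 1) / p) ≠ 0 := by positivity
    field_simp
  rw [e1, e2, e3] at h
  have h' := mul_le_mul_of_nonneg_left h hp0.le
  calc p * a ^ (p - 1) * b = p * (a ^ (p - 1) * b) := by ring
    _ ≤ _ := h'
    _ = _ := by field_simp

theorem rpow_sub_one_mul_self (hp : 1 < p) {a : ℝ} (ha : 0 ≤ a) : a ^ (p - 1) * a = a ^ p := by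
  rcases ha.eq_or_lt with rfl | ha
  · rw [mul_zero, Real.zero_rpow (by linarith)]
  · rw [← Real.rpow_add_one ha.ne', sub_add_cancel]

/-- Bound for the driver integrated against a probability measure. -/
theorem ofReal_mul_abs_integral_le {K : Type*} [MeasurableSpace K] {κ : Measure K}
    [IsProbabilityMeasure κ] (hp : 1 < p) {L L' δ c e y : ℝ} (hL : 0 ≤ L) (hL' : 0 ≤ L')
    (hδ : 0 < δ) (hc : 0 < c) (he : 0 < e) {f₀ f₁ f₂ ζ : K → ℝ} (hf₀ : Measurable f₀)
    (h₁ : ∀ x, |f₁ x - f₀ x| ≤ L' * |y|)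
    (h₂ : ∫⁻ x, ENNReal.ofReal |f₂ x - f₁ x| ∂κ ≤
      ENNReal.ofReal L * (∫⁻ x, ENNReal.ofReal (|ζ x| ^ p) ∂κ) ^ (1 / p)) :
    ENNReal.ofReal (p * |y| ^ (p - 1) * e * |∫ x, f₂ x ∂κ|) ≤
      ENNReal.ofReal ((p - 1) * δ + p * L' + (p - 1) * c) * ENNReal.ofReal (|y| ^ p * e) +
        ENNReal.ofReal (δ ^ (1 - p)) * ∫⁻ x, ENNReal.ofReal (|f₀ x| ^ p * e) ∂κ +
        ENNReal.ofReal (L ^ p * c ^ (1 - p)) * ∫⁻ x, ENNReal.ofReal (|ζ x| ^ p * e) ∂κ := by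
  have hp1 : 0 < p - 1 := by linarith
  have hp0 : 0 < p := by linarith
  set w := ∫⁻ x, ENNReal.ofReal (|ζ x| ^ p) ∂κ with hw
  have hA : 0 ≤ p * |y| ^ (p - 1) * e := by positivity
  have hderiv : ENNReal.ofReal |∫ x, f₂ x ∂κ| ≤
      ∫⁻ x, ENNReal.ofReal |f₀ x| ∂κ + ENNReal.ofReal (L' * |y|) +
        ENNReal.ofReal L * w ^ (1 / p) := by
    calc ENNReal.ofReal |∫ x, f₂ x ∂κ| ≤ ∫⁻ x, ENNReal.ofReal |f₂ x| ∂κ := by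
          simpa only [Real.enorm_eq_ofReal_abs] using enorm_integral_le_lintegral_enorm (μ := κ) f₂
      _ ≤ ∫⁻ x, ((ENNReal.ofReal |f₀ x| + ENNReal.ofReal (L' * |y|)) +
            ENNReal.ofReal |f₂ x - f₁ x|) ∂κ := by
          refine lintegral_mono fun x => ?_
          rw [← ENNReal.ofReal_add (by positivity) (by positivity),
            ← ENNReal.ofReal_add (by positivity) (by positivity)]
          refine ENNReal.ofReal_le_ofReal ?_
          have h3 : |f₂ x| ≤ |f₂ x - f₁ x| + |f₁ x - f₀ x| + |f₀ x| := by
            calc |f₂ x| = |(f₂ x - f₁ x) + (f₁ x - f₀ x) + f₀ x| := by ring_nf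
              _ ≤ _ := abs_add_three _ _ _
          linarith [h₁ x]
      _ = ∫⁻ x, ENNReal.ofReal |f₀ x| ∂κ + ENNReal.ofReal (L' * |y|) +
            ∫⁻ x, ENNReal.ofReal |f₂ x - f₁ x| ∂κ := by
          have m0 : Measurable fun x => ENNReal.ofReal |f₀ x| := hf₀.abs.ennreal_ofReal
          have m1 : Measurable fun x => ENNReal.ofReal |f₀ x| + ENNReal.ofReal (L' * |y|) :=
            m0.add measurable_const
          rw [lintegral_add_left m1, lintegral_add_left m0, lintegral_const,
            measure_univ, mul_one]
      _ ≤ _ := by gcongr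
  -- Young with the free parameter δ, pointwise in x. The L' term below needs no Young: it is
  -- already proportional to |y|^p.
  have t1 : ENNReal.ofReal (p * |y| ^ (p - 1) * e) * ∫⁻ x, ENNReal.ofReal |f₀ x| ∂κ ≤
      ENNReal.ofReal ((p - 1) * δ * (|y| ^ p * e)) +
        ENNReal.ofReal (δ ^ (1 - p)) * ∫⁻ x, ENNReal.ofReal (|f₀ x| ^ p * e) ∂κ := by
    rw [← lintegral_const_mul' _ _ ENNReal.ofReal_ne_top,
      ← lintegral_const_mul' _ _ ENNReal.ofReal_ne_top]
    have : ENNReal.ofReal ((p - 1) * δ * (|y| ^ p * e)) =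
        ∫⁻ _, ENNReal.ofReal ((p - 1) * δ * (|y| ^ p * e)) ∂κ := by simp
    rw [this, ← lintegral_add_left measurable_const]
    refine lintegral_mono fun x => ?_
    rw [← ENNReal.ofReal_mul hA, ← ENNReal.ofReal_mul (by positivity),
      ← ENNReal.ofReal_add (by positivity) (by positivity)]
    refine ENNReal.ofReal_le_ofReal ?_
    have := mul_le_mul_of_nonneg_right
      (mul_rpow_sub_one_mul_le hp (abs_nonneg y) (abs_nonneg (f₀ x)) hδ) he.le
    linarith
  have t2 : ENNReal.ofReal (p * |y| ^ (p - 1) * e) * ENNReal.ofReal (L' * |y|) =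
      ENNReal.ofReal (p * L' * (|y| ^ p * e)) := by
    rw [← ENNReal.ofReal_mul hA, ← rpow_sub_one_mul_self hp (abs_nonneg y)]
    congr 1; ring
  have hwe : ∫⁻ x, ENNReal.ofReal (|ζ x| ^ p * e) ∂κ = w * ENNReal.ofReal e := by
    rw [hw, ← lintegral_mul_const' _ _ ENNReal.ofReal_ne_top]
    refine lintegral_congr fun x => ?_
    rw [← ENNReal.ofReal_mul (by positivity)]
  have t3 : ENNReal.ofReal (p * |y| ^ (p - 1) * e) * (ENNReal.ofReal L * w ^ (1 / p)) ≤
      ENNReal.ofReal ((p - 1) * c * (|y| ^ p * e)) +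
        ENNReal.ofReal (L ^ p * c ^ (1 - p)) * ∫⁻ x, ENNReal.ofReal (|ζ x| ^ p * e) ∂κ := by
    rw [hwe]
    rcases hL.eq_or_lt with rfl | hL0
    · simp
    rcases eq_or_ne w ∞ with hwt | hwt
    · have h1 : ENNReal.ofReal (L ^ p * c ^ (1 - p)) ≠ 0 := by
        rw [Ne, ENNReal.ofReal_eq_zero, not_le]; positivity
      have h2 : ENNReal.ofReal e ≠ 0 := by rwa [Ne, ENNReal.ofReal_eq_zero, not_le]
      rw [hwt, ENNReal.top_mul h2, ENNReal.mul_top h1]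
      simp
    · have e1 : w ^ (1 / p) = ENNReal.ofReal (w.toReal ^ (1 / p)) := by
        rw [← ENNReal.ofReal_rpow_of_nonneg ENNReal.toReal_nonneg (by positivity),
          ENNReal.ofReal_toReal hwt]
      have e2 : w = ENNReal.ofReal ((w.toReal ^ (1 / p)) ^ p) := by
        rw [← Real.rpow_mul ENNReal.toReal_nonneg, one_div_mul_cancel hp0.ne', Real.rpow_one,
          ENNReal.ofReal_toReal hwt]
      rw [e1]
      conv_rhs => rw [e2]
      set s := w.toReal ^ (1 / p)
      have hs : 0 ≤ s := by positivity
      rw [← ENNReal.ofReal_mul hL, ← ENNReal.ofReal_mul hA, ← ENNReal.ofReal_mul (by positivity),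
        ← ENNReal.ofReal_mul (by positivity), ← ENNReal.ofReal_add (by positivity) (by positivity)]
      refine ENNReal.ofReal_le_ofReal ?_
      have := mul_le_mul_of_nonneg_right
        (mul_rpow_sub_one_mul_le hp (abs_nonneg y) (mul_nonneg hL hs) hc) he.le
      rw [Real.mul_rpow hL hs] at this
      linarith
  rw [ENNReal.ofReal_mul hA]
  refine (mul_le_mul_right hderiv _).trans ?_
  rw [mul_add, mul_add, t2]
  refine (add_le_add (add_le_add t1 le_rfl) t3).trans_eq ?_
  have : ENNReal.ofReal ((p - 1) * δ + p * L' + (p - 1) * c) * ENNReal.ofReal (|y| ^ p * e) =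
      ENNReal.ofReal ((p - 1) * δ * (|y| ^ p * e)) + ENNReal.ofReal (p * L' * (|y| ^ p * e)) +
        ENNReal.ofReal ((p - 1) * c * (|y| ^ p * e)) := by
    rw [← ENNReal.ofReal_mul (by positivity), ← ENNReal.ofReal_add (by positivity) (by positivity),
      ← ENNReal.ofReal_add (by positivity) (by positivity)]
    congr 1; ring
  rw [this]
  abel

end Inequalities

end BSDE

/-! ### The pathwise estimate for a solution. -/

namespace BSDE

variable {T : ℝ≥0} {K Ω : Type*} [MeasurableSpace K] [MeasurableSpace Ω] {P : Measure Ω}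
  {N : MarkedPointProcess T K P}

/-- A path with strictly increasing jump times has finitely many, pairwise distinct, jumps. -/
theorem MarkedPointProcess.exists_jumpMeasure_eq_sum (N : MarkedPointProcess T K P) {ω : Ω}
    (hω : ∀ n, N.S n ω ≠ ⊤ → N.S n ω < N.S (n + 1) ω) :
    ∃ (I : Finset ℕ) (τ : ℕ → Time T), InjOn τ I ∧ (∀ i ∈ I, ⊥ < τ i) ∧
      N.jumpMeasure ω = ∑ i ∈ I, Measure.dirac (τ i, N.X i ω) := by
  classical
  obtain ⟨M, hM⟩ := N.exists_S_eq_top ω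
  have hmono : Monotone fun n => N.S n ω := monotone_nat_of_le_succ fun n => N.S_le_succ n ω
  have hlt : ∀ i j, N.S i ω ≠ ⊤ → i < j → N.S i ω < N.S j ω := fun i j hi hij =>
    (hω i hi).trans_le (hmono hij)
  set I : Finset ℕ := {n ∈ Finset.range M | N.S n ω ≠ ⊤} with hI
  -- The default ⊥ is never used: I contains only indices of jumps that occur.
  set τ : ℕ → Time T := fun n => (N.S n ω).untopD ⊥ with hτ
  have hS : ∀ n, N.S n ω ≠ ⊤ → N.S n ω = τ n := fun n hn => by
    obtain ⟨s, hs⟩ := WithTop.ne_top_iff_exists.1 hn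
    simp only [hτ, ← hs, WithTop.untopD_coe]
  have hmem : ∀ n, n ∈ I ↔ N.S n ω ≠ ⊤ := by
    intro n
    simp only [hI, Finset.mem_filter, Finset.mem_range, and_iff_right_iff_imp]
    intro hn
    by_contra hle
    exact hn (top_le_iff.1 (hM ▸ hmono (not_lt.1 hle)))
  refine ⟨I, τ, ?_, ?_, ?_⟩
  · intro i hi j hj hij
    have hi := (hmem i).1 hi
    have hj := (hmem j).1 hj
    have heq : N.S i ω = N.S j ω := by rw [hS i hi, hS j hj, hij]
    rcases lt_trichotomy i j with h | h | h
    · exact absurd heq (hlt i j hi h).ne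
    · exact h
    · exact absurd heq (hlt j i hj h).ne'
  · intro i hi
    have := N.S_pos i ω
    rw [hS i ((hmem i).1 hi)] at this
    exact WithTop.coe_lt_coe.1 this
  · ext s hs
    rw [MarkedPointProcess.jumpMeasure, Measure.sum_apply _ hs, Measure.finsetSum_apply,
      tsum_eq_sum (s := I)]
    · refine Finset.sum_congr rfl fun i hi => ?_
      rw [hS i ((hmem i).1 hi)]
    · intro i hi
      have : N.S i ω = ⊤ := by simpa [hmem] using hi
      rw [this]; rfl

section JumpSums

variable [MeasurableSingletonClass K]

open Classical in
theorem setLIntegral_sum_dirac (I : Finset ℕ) (τ : ℕ → Time T) (x : ℕ → K) (t : Time T)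
    (h : Time T × K → ℝ≥0∞) :
    ∫⁻ q in Ioi t ×ˢ univ, h q ∂(∑ i ∈ I, Measure.dirac (τ i, x i)) =
      ∑ i ∈ I with t < τ i, h (τ i, x i) := by
  rw [← lintegral_indicator (measurableSet_Ioi.prod MeasurableSet.univ),
    lintegral_finsetSum_measure, Finset.sum_filter]
  refine Finset.sum_congr rfl fun i _ => ?_
  rw [lintegral_dirac]
  simp [indicator_apply]

open Classical in
theorem setIntegral_sum_dirac (I : Finset ℕ) (τ : ℕ → Time T) (x : ℕ → K) (t : Time T)
    (h : Time T × K → ℝ) :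
    ∫ q in Ioi t ×ˢ univ, h q ∂(∑ i ∈ I, Measure.dirac (τ i, x i)) =
      ∑ i ∈ I with t < τ i, h (τ i, x i) := by
  rw [← integral_indicator (measurableSet_Ioi.prod MeasurableSet.univ),
    integral_finsetSum_measure fun i _ => integrable_dirac (by finiteness), Finset.sum_filter]
  refine Finset.sum_congr rfl fun i _ => ?_
  rw [integral_dirac]
  simp [indicator_apply]

end JumpSums

theorem Compensator.measurable_A (c : Compensator N) (t : Time T) :
    Measurable fun ω => c.A ω t :=
  (c.predictable_A.mono (predictable_le N.filtration) le_rfl).comp measurable_prodMk_left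

variable {c : Compensator N} {p β : ℝ} {ξ : Ω → ℝ} {f : Time T → Ω → K → ℝ → (K → ℝ) → ℝ}
  {Y : Time T → Ω → ℝ} {Z : Time T → Ω → K → ℝ}

/-- Pathwise estimate for `|Y| ^ p * exp (β A)` along a solution. -/
theorem IsSolution.ae_pathwise [MeasurableSingletonClass K] (hsol : IsSolution c ξ f Y Z)
    (hp : 1 < p) (hβ : 0 ≤ β) (hA : ∀ᵐ ω ∂P, Continuous (c.A ω)) :
    ∀ᵐ ω ∂P, (∀ᵐ r ∂(c.A ω).measure, Function.leftLim (fun s => Y s ω) r = Y r ω) ∧ ∀ t,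
      ENNReal.ofReal (|Y t ω| ^ p * Real.exp (β * c.A ω t)) +
        ENNReal.ofReal β * ∫⁻ r in Ioi t, ENNReal.ofReal
          (|Function.leftLim (fun s => Y s ω) r| ^ p * Real.exp (β * c.A ω r)) ∂(c.A ω).measure +
        ∫⁻ q in Ioi t ×ˢ univ, ENNReal.ofReal
          (|Function.leftLim (fun s => Y s ω) q.1 + Z q.1 ω q.2| ^ p * Real.exp (β * c.A ω q.1))
            ∂(N.jumpMeasure ω) ≤
      ENNReal.ofReal (|ξ ω| ^ p * Real.exp (β * c.A ω ⊤)) +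
        ∫⁻ r in Ioi t, ENNReal.ofReal
          (p * |Function.leftLim (fun s => Y s ω) r| ^ (p - 1) * Real.exp (β * c.A ω r) *
            |∫ x, f r ω x (Function.leftLim (fun s => Y s ω) r) (Z r ω) ∂(c.φ (r, ω))|)
            ∂(c.A ω).measure +
        ∫⁻ q in Ioi t ×ˢ univ, ENNReal.ofReal
          (|Function.leftLim (fun s => Y s ω) q.1| ^ p * Real.exp (β * c.A ω q.1))
            ∂(N.jumpMeasure ω) := by
  filter_upwards [hA, hsol.integrable_f, hsol.equation, N.S_lt_succ] with ω hA hf heq hS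
  obtain ⟨I, τ, hτ, hτ0, hμ⟩ := N.exists_jumpMeasure_eq_sum hS
  have := nullSingletonClass_stieltjes hA
  classical
  -- Fubini for ν turns the driver into the density r ↦ ∫ f dφ with respect to dA, the form the
  -- chain rule requires.
  have hg : Integrable (fun r => ∫ x, f r ω x (Function.leftLim (fun s => Y s ω) r) (Z r ω)
      ∂(c.φ (r, ω))) (c.A ω).measure := by
    have h := Integrable.integral_compProd hf
    simp only [Kernel.prodMkLeft_apply, Kernel.const_apply] at h
    exact h
  have hy : ∀ t, Y t ω + ∑ i ∈ I with t < τ i, Z (τ i) ω (N.X i ω) = ξ ω + ∫ r in Ioi t,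
      ∫ x, f r ω x (Function.leftLim (fun s => Y s ω) r) (Z r ω) ∂(c.φ (r, ω))
        ∂(c.A ω).measure := by
    intro t
    have h := heq t
    rw [hμ, setIntegral_sum_dirac, Compensator.ν, Measure.setIntegral_compProd measurableSet_Ioi
      MeasurableSet.univ hf.integrableOn] at h
    simp only [Measure.restrict_univ] at h
    exact h
  refine ⟨ae_leftLim_eq hg hy, fun t => ?_⟩
  rw [hμ, setLIntegral_sum_dirac, setLIntegral_sum_dirac]
  exact ofReal_rpow_abs_mul_exp_le hp hβ hg hτ hτ0 (stieltjes_eq_sub_real_Ioi (c.A ω)) hy t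

end BSDE

/-! ### Absorption, and expectations of dA-integrals. -/

namespace BSDE

/-- Absorption step of the a priori estimate. -/
theorem estimate_of_le {p β L L' ε δ c : ℝ} (hp : 1 < p) (hL : 0 ≤ L) (hL' : 0 ≤ L') (hε : 0 < ε)
    (hδ : 0 < δ) (hc : 0 < c) {η : ℝ} (hη : 0 < η)
    (h_coeff : 1 + Cε p ε / (1 + ε) + ((p - 1) * δ + p * L' + (p - 1) * c) + η ≤ β)
    (h_coeff' : L ^ p * c ^ (1 - p) + η ≤ 1 / (1 + ε)) {y a b z x d : ℝ≥0∞}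
    (ha : a ≠ ∞) (hz : z ≠ ∞) (hx : x ≠ ∞) (hd : d ≠ ∞)
    (h : y + ENNReal.ofReal β * a + b ≤ x +
      (ENNReal.ofReal ((p - 1) * δ + p * L' + (p - 1) * c) * a + ENNReal.ofReal (δ ^ (1 - p)) * d +
        ENNReal.ofReal (L ^ p * c ^ (1 - p)) * z) + a)
    (hzb : z ≤ ENNReal.ofReal (1 + ε) * b + ENNReal.ofReal (Cε p ε) * a) :
    y ≤ (max 1 (δ ^ (1 - p))).toNNReal * (x + d) ∧
      a + z ≤ (max 1 (δ ^ (1 - p)) / η).toNNReal * (x + d) := by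
  -- In the application y is the expectation at time t; a, b, z are the weighted norms of Y_-, Y_- +
  -- Z, Z; x and d are those of ξ and f(·,0,0).
  have hp1 : 0 < p - 1 := by linarith
  have hC := Cε_nonneg hp hε
  have hβ : 0 ≤ β := by
    have : 0 ≤ Cε p ε / (1 + ε) := by positivity
    have : 0 ≤ (p - 1) * δ + p * L' + (p - 1) * c := by positivity
    linarith
  -- A finite right side forces b and y to be finite, so the inequality can be moved to the reals,
  -- where subtraction is legitimate.
  have hfin : x + (ENNReal.ofReal ((p - 1) * δ + p * L' + (p - 1) * c) * a +
      ENNReal.ofReal (δ ^ (1 - p)) * d + ENNReal.ofReal (L ^ p * c ^ (1 - p)) * z) + a ≠ ∞ := by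
    finiteness
  have hlhs := ne_top_of_le_ne_top hfin h
  have hb : b ≠ ∞ := ne_top_of_le_ne_top hlhs le_add_self
  have hy : y ≠ ∞ := ne_top_of_le_ne_top hlhs (by rw [add_assoc]; exact le_self_add)
  lift y to ℝ≥0 using hy
  lift a to ℝ≥0 using ha
  lift b to ℝ≥0 using hb
  lift z to ℝ≥0 using hz
  lift x to ℝ≥0 using hx
  lift d to ℝ≥0 using hd
  have hδp : 0 < δ ^ (1 - p) := by positivity
  have hκ₃ : 0 ≤ L ^ p * c ^ (1 - p) := by positivity
  have hκ₁ : 0 ≤ (p - 1) * δ + p * L' + (p - 1) * c := by positivity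
  set κ₁ := (p - 1) * δ + p * L' + (p - 1) * c
  set κ₂ := δ ^ (1 - p)
  set κ₃ := L ^ p * c ^ (1 - p)
  simp only [ENNReal.ofReal] at h hzb
  norm_cast at h hzb ⊢
  rw [← NNReal.coe_le_coe] at h hzb
  push_cast at h hzb
  rw [Real.coe_toNNReal _ hβ, Real.coe_toNNReal _ hκ₁, Real.coe_toNNReal _ hδp.le,
    Real.coe_toNNReal _ hκ₃] at h
  rw [Real.coe_toNNReal _ (by positivity), Real.coe_toNNReal _ hC] at hzb
  -- Read as a lower bound for b, this is the source of 1/(1+ε) and C_ε/(1+ε) in the two coefficient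
  -- conditions.
  have hzb' : (z : ℝ) / (1 + ε) ≤ b + Cε p ε / (1 + ε) * a := by
    rw [div_le_iff₀ (by positivity)]
    calc (z : ℝ) ≤ _ := hzb
      _ = _ := by field_simp
  have h1 := mul_le_mul_of_nonneg_right h_coeff a.2
  have h2 := mul_le_mul_of_nonneg_right h_coeff' z.2
  simp only [NNReal.val_eq_coe] at h1 h2
  have h3 : κ₂ * d ≤ max 1 κ₂ * d := mul_le_mul_of_nonneg_right (le_max_right _ _) d.2
  have h4 : 1 * (x : ℝ) ≤ max 1 κ₂ * x := mul_le_mul_of_nonneg_right (le_max_left _ _) x.2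
  -- The two coefficient conditions, multiplied by a and z, absorb both norms and leave the slack η
  -- on the left.
  have key : (y : ℝ) + η * (a + z) ≤ max 1 κ₂ * (x + d) := by
    have : (1 / (1 + ε)) * (z : ℝ) = z / (1 + ε) := by ring
    nlinarith
  have hm : 0 ≤ max 1 κ₂ := by positivity
  constructor
  · rw [← NNReal.coe_le_coe]
    push_cast
    rw [Real.coe_toNNReal _ hm]
    have : 0 ≤ η * ((a : ℝ) + z) := by positivity
    linarith
  · rw [← NNReal.coe_le_coe]
    push_cast
    rw [Real.coe_toNNReal _ (by positivity), div_mul_eq_mul_div, le_div_iff₀ hη]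
    have : (0 : ℝ) ≤ y := y.2
    linarith

variable {T : ℝ≥0} {K Ω : Type*} [MeasurableSpace K] [MeasurableSpace Ω] {P : Measure Ω}
  {N : MarkedPointProcess T K P}

section Expectation

variable (c : Compensator N)

/-- The functional `H ↦ E ∫_{(t, T]} H_s dA_s`. -/
noncomputable def expIntegral (t : Time T) (H : Time T × Ω → ℝ≥0∞) : ℝ≥0∞ :=
  ∫⁻ ω, ∫⁻ r in Ioi t, H (r, ω) ∂(c.A ω).measure ∂P

theorem measurable_setLIntegral_stieltjes (t : Time T) {H : Time T × Ω → ℝ≥0∞}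
    (hH : Measurable H) : Measurable fun ω => ∫⁻ r in Ioi t, H (r, ω) ∂(c.A ω).measure := by
  have h := measurable_lintegral_stieltjes c.measurable_A
    (hH.indicator (measurableSet_Ioi.prod MeasurableSet.univ : MeasurableSet (Ioi t ×ˢ univ)))
  convert h using 2 with ω
  rw [← lintegral_indicator measurableSet_Ioi]
  refine lintegral_congr fun r => ?_
  simp [indicator_apply]

theorem expIntegral_add (t : Time T) {H₁ H₂ : Time T × Ω → ℝ≥0∞} (h₁ : Measurable H₁) :
    expIntegral c t (fun q => H₁ q + H₂ q) = expIntegral c t H₁ + expIntegral c t H₂ := by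
  rw [expIntegral, expIntegral, expIntegral,
    ← lintegral_add_left (measurable_setLIntegral_stieltjes c t h₁)]
  exact lintegral_congr fun ω => lintegral_add_left (h₁.comp measurable_prodMk_right) _

theorem expIntegral_const_mul (t : Time T) (r : ℝ≥0∞) {H : Time T × Ω → ℝ≥0∞}
    (hH : Measurable H) : expIntegral c t (fun q => r * H q) = r * expIntegral c t H := by
  rw [expIntegral, expIntegral, ← lintegral_const_mul _ (measurable_setLIntegral_stieltjes c t hH)]
  exact lintegral_congr fun ω => lintegral_const_mul _ (hH.comp measurable_prodMk_right)

theorem expIntegral_mono (t : Time T) {H₁ H₂ : Time T × Ω → ℝ≥0∞} (h : ∀ q, H₁ q ≤ H₂ q) :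
    expIntegral c t H₁ ≤ expIntegral c t H₂ :=
  lintegral_mono fun _ => lintegral_mono fun _ => h _

theorem expIntegral_le_bot (t : Time T) (H : Time T × Ω → ℝ≥0∞) :
    expIntegral c t H ≤ expIntegral c ⊥ H :=
  lintegral_mono fun _ => lintegral_mono_set (Ioi_subset_Ioi bot_le)

instance isMarkovKernel_φ : @IsMarkovKernel _ _ N.predictable _ c.φ :=
  @IsMarkovKernel.mk _ _ N.predictable _ c.φ c.isProbabilityMeasure_φ

theorem measurable_lintegral_φ {H : (Time T × Ω) × K → ℝ≥0∞}
    (hH : Measurable[N.predictable.prod ‹MeasurableSpace K›] H) :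
    Measurable fun q : Time T × Ω => ∫⁻ x, H (q, x) ∂(c.φ q) := by
  have h : Measurable[N.predictable] fun q : Time T × Ω => ∫⁻ x, H (q, x) ∂(c.φ q) :=
    @Measurable.lintegral_kernel_prod_right' _ _ N.predictable _ c.φ _ H hH
  exact h.mono (predictable_le N.filtration) le_rfl

theorem measurable_section {X : Type*} [MeasurableSpace X] {H : (Time T × Ω) × K → X}
    (hH : Measurable[N.predictable.prod ‹MeasurableSpace K›] H) (ω : Ω) :
    Measurable fun q : Time T × K => H ((q.1, ω), q.2) := by
  have h : Measurable H := hH.mono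
    (sup_le_sup (MeasurableSpace.comap_mono (predictable_le N.filtration)) le_rfl) le_rfl
  exact h.comp (by fun_prop)

theorem setLIntegral_ν {H : (Time T × Ω) × K → ℝ≥0∞}
    (hH : Measurable[N.predictable.prod ‹MeasurableSpace K›] H) (ω : Ω) (t : Time T) :
    ∫⁻ q in Ioi t ×ˢ univ, H ((q.1, ω), q.2) ∂(c.ν ω) =
      ∫⁻ r in Ioi t, ∫⁻ x, H ((r, ω), x) ∂(c.φ (r, ω)) ∂(c.A ω).measure := by
  rw [Compensator.ν, Measure.setLIntegral_compProd (measurable_section hH ω) measurableSet_Ioi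
    MeasurableSet.univ]
  simp only [Measure.restrict_univ]
  rfl

theorem lintegral_ν_eq_Ioi_bot {H : (Time T × Ω) × K → ℝ≥0∞}
    (hH : Measurable[N.predictable.prod ‹MeasurableSpace K›] H) (ω : Ω) :
    ∫⁻ q, H ((q.1, ω), q.2) ∂(c.ν ω) =
      ∫⁻ r in Ioi ⊥, ∫⁻ x, H ((r, ω), x) ∂(c.φ (r, ω)) ∂(c.A ω).measure := by
  have hres : (c.A ω).measure.restrict (Ioi ⊥) = (c.A ω).measure := by
    refine Measure.restrict_eq_self_of_ae_mem ?_
    have h := measure_eq_zero_iff_ae_notMem.1 (stieltjes_measure_singleton_bot (c.A ω))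
    filter_upwards [h] with r hr
    exact bot_lt_iff_ne_bot.2 hr
  rw [hres, Compensator.ν, Measure.lintegral_compProd (measurable_section hH ω)]
  rfl

/-- The first marginal of ν is dA, because φ has total mass one. -/
theorem ae_ν_of_ae {ω : Ω} {p : Time T → Prop} (h : ∀ᵐ r ∂(c.A ω).measure, p r) :
    ∀ᵐ q ∂(c.ν ω), p q.1 := by
  have hmap : ∀ᵐ r ∂((c.ν ω).map Prod.fst), p r := by
    have : (c.ν ω).map Prod.fst = (c.A ω).measure := Measure.fst_compProd _ (c.section_φ ω)
    rwa [this]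
  exact ae_of_ae_map measurable_fst.aemeasurable hmap

/-- The compensation formula on `(t, T]`. -/
theorem lintegral_setLIntegral_jumpMeasure {H : (Time T × Ω) × K → ℝ≥0∞}
    (hH : Measurable[N.predictable.prod ‹MeasurableSpace K›] H) (t : Time T) :
    ∫⁻ ω, ∫⁻ q in Ioi t ×ˢ univ, H ((q.1, ω), q.2) ∂(N.jumpMeasure ω) ∂P =
      expIntegral c t fun q => ∫⁻ x, H (q, x) ∂(c.φ q) := by
  -- The set (t, T] × Ω × K is predictable, so H times its indicator is admissible in the
  -- compensator identity.
  have hs : MeasurableSet[N.predictable.prod ‹MeasurableSpace K›]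
      ((Ioi t ×ˢ univ : Set (Time T × Ω)) ×ˢ (univ : Set K)) := by
    refine @MeasurableSet.prod _ _ N.predictable _ _ _ ?_ MeasurableSet.univ
    exact measurableSet_predictable_Ioi_prod MeasurableSet.univ
  have h := c.lintegral_eq _ (hH.indicator hs)
  have e1 : ∀ ω, ∫⁻ q in Ioi t ×ˢ univ, H ((q.1, ω), q.2) ∂(N.jumpMeasure ω) =
      ∫⁻ q, ((Ioi t ×ˢ univ : Set (Time T × Ω)) ×ˢ (univ : Set K)).indicator H ((q.1, ω), q.2)
        ∂(N.jumpMeasure ω) := by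
    intro ω
    rw [← lintegral_indicator (measurableSet_Ioi.prod MeasurableSet.univ)]
    refine lintegral_congr fun q => ?_
    simp [indicator_apply]
  simp_rw [e1]
  rw [h, expIntegral]
  refine lintegral_congr fun ω => ?_
  rw [← lintegral_indicator measurableSet_Ioi]
  refine lintegral_congr fun r => ?_
  by_cases hr : t < r <;> simp [hr]

end Expectation

end BSDE

/-! ### The estimate in expectation. -/

namespace BSDE

theorem measurable_ofReal_rpow_abs_mul_exp {α : Type*} [MeasurableSpace α] (p β : ℝ) {u a : α → ℝ}
    (hu : Measurable u) (ha : Measurable a) :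
    Measurable fun q => ENNReal.ofReal (|u q| ^ p * Real.exp (β * a q)) :=
  ((hu.abs.pow_const p).mul ((ha.const_mul β).exp)).ennreal_ofReal

variable {T : ℝ≥0} {K Ω : Type*} [MeasurableSpace K] [MeasurableSpace Ω] {P : Measure Ω}
  {N : MarkedPointProcess T K P} {c : Compensator N} {p β L L' : ℝ} {ξ : Ω → ℝ}
  {f : Time T → Ω → K → ℝ → (K → ℝ) → ℝ} {Y : Time T → Ω → ℝ} {Z : Time T → Ω → K → ℝ}

theorem Hypothesis.measurable_f_const (hH : Hypothesis c p β L L' ξ f) (y : ℝ) :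
    Measurable[N.predictable.prod ‹MeasurableSpace K›]
      fun q : (Time T × Ω) × K => f q.1.1 q.1.2 q.2 y 0 := by
  have hZ : N.PredictableFun fun _ _ => (0 : K → ℝ) := measurable_const
  have h := hH.predictable_f _ hZ
  have hy := @measurable_prodMk_right _ _ (N.predictable.prod ‹MeasurableSpace K›)
    Real.measurableSpace y
  exact h.comp hy

/-- The weighted `p`-th power of a predictable function is predictable. -/
theorem measurable_predictable_weight (c : Compensator N) (p β : ℝ) {u : (Time T × Ω) × K → ℝ}
    (hu : Measurable[N.predictable.prod ‹MeasurableSpace K›] u) :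
    Measurable[N.predictable.prod ‹MeasurableSpace K›]
      fun q => ENNReal.ofReal (|u q| ^ p * Real.exp (β * c.A q.1.2 q.1.1)) :=
  @measurable_ofReal_rpow_abs_mul_exp _ (N.predictable.prod ‹MeasurableSpace K›) p β u
    (fun q => c.A q.1.2 q.1.1) hu (c.predictable_A.comp (@measurable_fst _ _ N.predictable _))

theorem IsSolution.measurable_leftLim (hsol : IsSolution c ξ f Y Z) :
    Measurable[N.predictable.prod ‹MeasurableSpace K›]
      fun q : (Time T × Ω) × K => Function.leftLim (fun s => Y s q.1.2) q.1.1 :=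
  (measurable_leftLim_predictable N.filtration hsol.adapted
    fun ω t => (hsol.cadlag ω t).2).comp (@measurable_fst _ _ N.predictable _)

theorem IsSolution.measurable_leftLim_add (hsol : IsSolution c ξ f Y Z) :
    Measurable[N.predictable.prod ‹MeasurableSpace K›] fun q : (Time T × Ω) × K =>
      Function.leftLim (fun s => Y s q.1.2) q.1.1 + Z q.1.1 q.1.2 q.2 := by
  have hZ : Measurable[N.predictable.prod ‹MeasurableSpace K›]
    fun q : (Time T × Ω) × K => Z q.1.1 q.1.2 q.2 := hsol.predictable
  exact hsol.measurable_leftLim.fun_add hZ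

theorem IsSolution.measurable_weight_leftLim (hsol : IsSolution c ξ f Y Z) :
    Measurable fun q : Time T × Ω => ENNReal.ofReal
      (|Function.leftLim (fun s => Y s q.2) q.1| ^ p * Real.exp (β * c.A q.2 q.1)) :=
  measurable_ofReal_rpow_abs_mul_exp p β
    ((measurable_leftLim_predictable N.filtration hsol.adapted
      fun ω t => (hsol.cadlag ω t).2).mono (predictable_le N.filtration) le_rfl)
    (c.predictable_A.mono (predictable_le N.filtration) le_rfl)

/-- The driver, integrated over the marks, is controlled by `Y`, `Z` and `f(·, 0, 0)`. -/
theorem Hypothesis.driver_le (hH : Hypothesis c p β L L' ξ f) (hp : 1 < p) (hL : 0 ≤ L)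
    (hL' : 0 ≤ L') {δ d : ℝ} (hδ : 0 < δ) (hd : 0 < d) (hZ : N.PredictableFun Z) (y : ℝ)
    (r : Time T) (ω : Ω) :
    ENNReal.ofReal (p * |y| ^ (p - 1) * Real.exp (β * c.A ω r) *
        |∫ x, f r ω x y (Z r ω) ∂(c.φ (r, ω))|) ≤
      ENNReal.ofReal ((p - 1) * δ + p * L' + (p - 1) * d) *
          ENNReal.ofReal (|y| ^ p * Real.exp (β * c.A ω r)) +
        ENNReal.ofReal (δ ^ (1 - p)) *
          ∫⁻ x, ENNReal.ofReal (|f r ω x 0 0| ^ p * Real.exp (β * c.A ω r)) ∂(c.φ (r, ω)) +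
        ENNReal.ofReal (L ^ p * d ^ (1 - p)) *
          ∫⁻ x, ENNReal.ofReal (|Z r ω x| ^ p * Real.exp (β * c.A ω r)) ∂(c.φ (r, ω)) := by
  have := c.isProbabilityMeasure_φ (r, ω)
  have hZm : Measurable (Z r ω) := (measurable_section hZ ω).comp (measurable_prodMk_left (x := r))
  have hfm : Measurable fun x => f r ω x 0 0 :=
    (measurable_section (hH.measurable_f_const 0) ω).comp (measurable_prodMk_left (x := r))
  -- The intermediate driver is f(y, 0): Lipschitz in y down to f(0, 0), Lipschitz in ζ up to f(y,
  -- Z).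
  refine ofReal_mul_abs_integral_le hp hL hL' hδ hd (Real.exp_pos _) hfm
    (f₁ := fun x => f r ω x y 0) (fun x => ?_) ?_
  · simpa using hH.lipschitz_y r ω x 0 y 0 measurable_const
  · simpa using hH.lipschitz_ζ r ω y (Z r ω) 0 hZm measurable_const

/-- `E |Y_t|^p e^{β A_t} + β E ∫ |Y|^p e^{β A} dA + E ∫∫ |Y_- + Z|^p e^{β A} dν` is bounded by the
data, up to terms in `Y` and `Z`. -/
theorem IsSolution.lintegral_le [MeasurableSingletonClass K] (hsol : IsSolution c ξ f Y Z)
    (hH : Hypothesis c p β L L' ξ f)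
    (hp : 1 < p) (hβ : 0 ≤ β) (hL : 0 ≤ L) (hL' : 0 ≤ L') {δ d : ℝ} (hδ : 0 < δ) (hd : 0 < d)
    (hA : ∀ᵐ ω ∂P, Continuous (c.A ω)) (t : Time T) :
    ∫⁻ ω, ENNReal.ofReal (|Y t ω| ^ p * Real.exp (β * c.A ω t)) ∂P +
      ENNReal.ofReal β * expIntegral c t (fun q => ENNReal.ofReal
        (|Function.leftLim (fun s => Y s q.2) q.1| ^ p * Real.exp (β * c.A q.2 q.1))) +
      expIntegral c t (fun q => ∫⁻ x, ENNReal.ofReal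
        (|Function.leftLim (fun s => Y s q.2) q.1 + Z q.1 q.2 x| ^ p *
          Real.exp (β * c.A q.2 q.1)) ∂(c.φ q)) ≤
    ∫⁻ ω, ENNReal.ofReal (|ξ ω| ^ p * Real.exp (β * c.A ω ⊤)) ∂P +
      (ENNReal.ofReal ((p - 1) * δ + p * L' + (p - 1) * d) *
        expIntegral c t (fun q => ENNReal.ofReal
          (|Function.leftLim (fun s => Y s q.2) q.1| ^ p * Real.exp (β * c.A q.2 q.1))) +
      ENNReal.ofReal (δ ^ (1 - p)) * expIntegral c t (fun q => ∫⁻ x, ENNReal.ofReal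
        (|f q.1 q.2 x 0 0| ^ p * Real.exp (β * c.A q.2 q.1)) ∂(c.φ q)) +
      ENNReal.ofReal (L ^ p * d ^ (1 - p)) * expIntegral c t (fun q => ∫⁻ x, ENNReal.ofReal
        (|Z q.1 q.2 x| ^ p * Real.exp (β * c.A q.2 q.1)) ∂(c.φ q))) +
      expIntegral c t (fun q => ENNReal.ofReal
        (|Function.leftLim (fun s => Y s q.2) q.1| ^ p * Real.exp (β * c.A q.2 q.1))) := by
  set gY : Time T × Ω → ℝ≥0∞ := fun q => ENNReal.ofReal
    (|Function.leftLim (fun s => Y s q.2) q.1| ^ p * Real.exp (β * c.A q.2 q.1)) with hgY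
  set gf : Time T × Ω → ℝ≥0∞ := fun q => ∫⁻ x, ENNReal.ofReal
    (|f q.1 q.2 x 0 0| ^ p * Real.exp (β * c.A q.2 q.1)) ∂(c.φ q) with hgf
  set gZ : Time T × Ω → ℝ≥0∞ := fun q => ∫⁻ x, ENNReal.ofReal
    (|Z q.1 q.2 x| ^ p * Real.exp (β * c.A q.2 q.1)) ∂(c.φ q) with hgZ
  have mY := measurable_predictable_weight c p β hsol.measurable_leftLim
  have mgf : Measurable gf :=
    measurable_lintegral_φ c (measurable_predictable_weight c p β (hH.measurable_f_const 0))
  have mgZ : Measurable gZ :=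
    measurable_lintegral_φ c (measurable_predictable_weight c p β hsol.predictable)
  -- The weight of Y_- does not depend on the mark, so the jump sum of |Y_-|^p has the plain
  -- dA-integral as its expectation.
  have eY : (fun q => ∫⁻ _, gY q ∂(c.φ q)) = gY := by
    funext q
    have := c.isProbabilityMeasure_φ q
    simp
  have mgY : Measurable gY := hsol.measurable_weight_leftLim
  have jB := lintegral_setLIntegral_jumpMeasure c
    (measurable_predictable_weight c p β hsol.measurable_leftLim_add) t
  have jY := lintegral_setLIntegral_jumpMeasure c mY t
  simp only at jB jY
  have mξ : Measurable fun ω => ENNReal.ofReal (|ξ ω| ^ p * Real.exp (β * c.A ω ⊤)) :=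
    measurable_ofReal_rpow_abs_mul_exp p β (hH.measurable_ξ.mono (N.filtration.le _) le_rfl)
      (c.measurable_A ⊤)
  have mG : Measurable fun q => ENNReal.ofReal ((p - 1) * δ + p * L' + (p - 1) * d) * gY q +
      ENNReal.ofReal (δ ^ (1 - p)) * gf q + ENNReal.ofReal (L ^ p * d ^ (1 - p)) * gZ q := by
    fun_prop
  have mD := measurable_setLIntegral_stieltjes c t mG
  have eG : expIntegral c t (fun q => ENNReal.ofReal ((p - 1) * δ + p * L' + (p - 1) * d) * gY q +
      ENNReal.ofReal (δ ^ (1 - p)) * gf q + ENNReal.ofReal (L ^ p * d ^ (1 - p)) * gZ q) =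
      ENNReal.ofReal ((p - 1) * δ + p * L' + (p - 1) * d) * expIntegral c t gY +
      ENNReal.ofReal (δ ^ (1 - p)) * expIntegral c t gf +
      ENNReal.ofReal (L ^ p * d ^ (1 - p)) * expIntegral c t gZ := by
    rw [expIntegral_add c t ((mgY.const_mul _).fun_add (mgf.const_mul _)),
      expIntegral_add c t (mgY.const_mul _), expIntegral_const_mul c t _ mgY,
      expIntegral_const_mul c t _ mgf, expIntegral_const_mul c t _ mgZ]
  rw [← eG, ← jB]
  have jY' : expIntegral c t gY = ∫⁻ ω, ∫⁻ q in Ioi t ×ˢ univ, ENNReal.ofReal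
      (|Function.leftLim (fun s => Y s ω) q.1| ^ p * Real.exp (β * c.A ω q.1))
        ∂(N.jumpMeasure ω) ∂P := by
    rw [jY, ← eY]
  conv_rhs => rw [jY', expIntegral, ← lintegral_add_left mξ, ← lintegral_add_left (mξ.fun_add mD)]
  rw [expIntegral, ← lintegral_const_mul _ (measurable_setLIntegral_stieltjes c t mgY)]
  -- On the smaller side superadditivity of `∫⁻` suffices, which needs no measurability; the larger
  -- side was merged into one integral using measurability.
  refine (add_le_add_left (le_lintegral_add _ _) _).trans ((le_lintegral_add _ _).trans ?_)
  refine lintegral_mono_ae ?_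
  filter_upwards [hsol.ae_pathwise hp hβ hA] with ω hω
  refine (hω.2 t).trans ?_
  gcongr with r
  exact hH.driver_le hp hL hL' hδ hd hsol.predictable _ r ω

theorem rpow_abs_Z_le (hp : 1 < p) {ε : ℝ} (hε : 0 < ε) (hsol : IsSolution c ξ f Y Z)
    (t : Time T) :
    expIntegral c t (fun q => ∫⁻ x, ENNReal.ofReal
        (|Z q.1 q.2 x| ^ p * Real.exp (β * c.A q.2 q.1)) ∂(c.φ q)) ≤
      ENNReal.ofReal (1 + ε) * expIntegral c t (fun q => ∫⁻ x, ENNReal.ofReal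
        (|Function.leftLim (fun s => Y s q.2) q.1 + Z q.1 q.2 x| ^ p *
          Real.exp (β * c.A q.2 q.1)) ∂(c.φ q)) +
      ENNReal.ofReal (Cε p ε) * expIntegral c t (fun q => ENNReal.ofReal
        (|Function.leftLim (fun s => Y s q.2) q.1| ^ p * Real.exp (β * c.A q.2 q.1))) := by
  have mB := measurable_lintegral_φ c
    (measurable_predictable_weight c p β hsol.measurable_leftLim_add)
  have mY := hsol.measurable_weight_leftLim (p := p) (β := β)
  rw [← expIntegral_const_mul c t _ mB, ← expIntegral_const_mul c t _ mY,
    ← expIntegral_add c t (mB.const_mul _)]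
  refine expIntegral_mono c t fun q => ?_
  have := c.isProbabilityMeasure_φ q
  rw [← lintegral_const_mul' _ _ ENNReal.ofReal_ne_top]
  have e : ∀ r : ℝ≥0∞, r = ∫⁻ _, r ∂(c.φ q) := fun r => by simp
  conv_rhs => rw [e (ENNReal.ofReal (Cε p ε) * _), ← lintegral_add_right _ measurable_const]
  refine lintegral_mono fun x => ?_
  have hC := Cε_nonneg hp hε
  rw [← ENNReal.ofReal_mul (by positivity), ← ENNReal.ofReal_mul hC,
    ← ENNReal.ofReal_add (by positivity) (by positivity)]
  refine ENNReal.ofReal_le_ofReal ?_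
  have h := mul_le_mul_of_nonneg_right
    (rpow_abs_le hp hε (Function.leftLim (fun s => Y s q.2) q.1) (Z q.1 q.2 x))
    (Real.exp_pos (β * c.A q.2 q.1)).le
  linarith

/-- Y may be replaced by Y_- dA-almost everywhere, and [0, T] by (0, T] since dA has no mass at 0.
This transfers finiteness from L^p_β to the terms to be absorbed. -/
theorem IsSolution.normLp_eq [MeasurableSingletonClass K] (hsol : IsSolution c ξ f Y Z)
    (hp : 1 < p) (hβ : 0 ≤ β) (hA : ∀ᵐ ω ∂P, Continuous (c.A ω)) :
    normLp c p β Y Z = expIntegral c ⊥ (fun q => ENNReal.ofReal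
        (|Function.leftLim (fun s => Y s q.2) q.1| ^ p * Real.exp (β * c.A q.2 q.1))) +
      expIntegral c ⊥ (fun q => ∫⁻ x, ENNReal.ofReal
        (|Z q.1 q.2 x| ^ p * Real.exp (β * c.A q.2 q.1)) ∂(c.φ q)) := by
  have mZ := measurable_predictable_weight c p β hsol.predictable
  have mY := measurable_predictable_weight c p β hsol.measurable_leftLim
  have mY' := hsol.measurable_weight_leftLim (p := p) (β := β)
  rw [← expIntegral_add c ⊥ mY', normLp, expIntegral]
  refine lintegral_congr_ae ?_
  filter_upwards [hsol.ae_pathwise hp hβ hA] with ω hω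
  have h1 : ∫⁻ q, ENNReal.ofReal ((|Y q.1 ω| ^ p + |Z q.1 ω q.2| ^ p) *
      Real.exp (β * c.A ω q.1)) ∂(c.ν ω) =
      ∫⁻ q, (ENNReal.ofReal (|Function.leftLim (fun s => Y s ω) q.1| ^ p *
        Real.exp (β * c.A ω q.1)) +
        ENNReal.ofReal (|Z q.1 ω q.2| ^ p * Real.exp (β * c.A ω q.1))) ∂(c.ν ω) := by
    refine lintegral_congr_ae ?_
    filter_upwards [ae_ν_of_ae c hω.1] with q hq
    rw [hq, add_mul, ENNReal.ofReal_add (by positivity) (by positivity)]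
  rw [h1, lintegral_add_left (measurable_section mY ω), lintegral_ν_eq_Ioi_bot c mY,
    lintegral_ν_eq_Ioi_bot c mZ]
  refine Eq.trans ?_ (lintegral_add_left (mY'.comp measurable_prodMk_right) _).symm
  congr 1
  refine lintegral_congr fun r => ?_
  have := c.isProbabilityMeasure_φ (r, ω)
  simp

theorem Hypothesis.dataBound_eq (hH : Hypothesis c p β L L' ξ f) (t : Time T) :
    dataBound c p β ξ f t = ∫⁻ ω, ENNReal.ofReal (|ξ ω| ^ p * Real.exp (β * c.A ω ⊤)) ∂P +
      expIntegral c t (fun q => ∫⁻ x, ENNReal.ofReal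
        (|f q.1 q.2 x 0 0| ^ p * Real.exp (β * c.A q.2 q.1)) ∂(c.φ q)) := by
  have mξ : Measurable fun ω => ENNReal.ofReal (|ξ ω| ^ p * Real.exp (β * c.A ω ⊤)) :=
    measurable_ofReal_rpow_abs_mul_exp p β (hH.measurable_ξ.mono (N.filtration.le _) le_rfl)
      (c.measurable_A ⊤)
  rw [dataBound, lintegral_add_left mξ, expIntegral]
  congr 1
  exact lintegral_congr fun ω =>
    setLIntegral_ν c (measurable_predictable_weight c p β (hH.measurable_f_const 0)) ω t

theorem Hypothesis.expIntegral_f_zero_ne_top (hH : Hypothesis c p β L L' ξ f) (t : Time T) :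
    expIntegral c t (fun q => ∫⁻ x, ENNReal.ofReal
        (|f q.1 q.2 x 0 0| ^ p * Real.exp (β * c.A q.2 q.1)) ∂(c.φ q)) ≠ ∞ := by
  refine ne_top_of_le_ne_top (hH.integrable_f_zero.ne) ((expIntegral_le_bot c t _).trans_eq ?_)
  refine lintegral_congr fun ω => ?_
  rw [← lintegral_ν_eq_Ioi_bot c (measurable_predictable_weight c p β (hH.measurable_f_const 0))]
  simp_rw [mul_comm (Real.exp _)]

end BSDE

/-! ### Choice of the parameters and conclusion. -/

open MeasureTheory ProbabilityTheory NNReal ENNReal BSDE in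
theorem lemma3p2 (p β L L' ε : ℝ) (hp : 1 < p) (hL : 0 ≤ L) (hL' : 0 ≤ L') (hε : 0 < ε)
    (hβ : 1 + Cε p ε / (1 + ε) + p * L' + (p - 1) * (L ^ p * (1 + ε)) ^ (1 / (p - 1)) < β) :
    ∃ C₁ C₂ : ℝ≥0, ∀ (T : ℝ≥0) (_ : 0 < T)
      (Ω : Type*) [MeasurableSpace Ω] (P : Measure Ω) [IsProbabilityMeasure P] [P.IsComplete]
      (K : Type*) [MeasurableSpace K] [StandardBorelSpace K]
      (N : MarkedPointProcess T K P) (c : Compensator N)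
      (_ : ∀ᵐ ω ∂P, Continuous (c.A ω))
      (ξ : Ω → ℝ) (f : Time T → Ω → K → ℝ → (K → ℝ) → ℝ)
      (_ : Hypothesis c p β L L' ξ f)
      (Y : Time T → Ω → ℝ) (Z : Time T → Ω → K → ℝ)
      (_ : MemLpβ c p β Y Z) (_ : IsSolution c ξ f Y Z),
      (∀ t : Time T, ∫⁻ ω, ENNReal.ofReal (|Y t ω| ^ p * Real.exp (β * c.A ω t)) ∂P ≤
        C₁ * dataBound c p β ξ f t) ∧
      normLp c p β Y Z ≤ C₂ * dataBound c p β ξ f ⊥ := by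
  have hp1 : 0 < p - 1 := by linarith
  have hC : 0 ≤ Cε p ε / (1 + ε) := div_nonneg (Cε_nonneg hp hε) (by positivity)
  -- For L > 0 this is the value of c at which L^p c^(1-p) = 1/(1+ε), so any larger c leaves slack
  -- in the Z coefficient.
  set c₀ : ℝ := (L ^ p * (1 + ε)) ^ (1 / (p - 1)) with hc₀
  have hc₀0 : 0 ≤ c₀ := by positivity
  set κ := β - (1 + Cε p ε / (1 + ε) + p * L' + (p - 1) * c₀) with hκ
  have hκ0 : 0 < κ := by linarith
  have hβ0 : 0 ≤ β := by
    have : 0 ≤ p * L' + (p - 1) * c₀ := by positivity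
    linarith
  -- δ serves twice, as the Young parameter for f(·,0,0) and as the increment in c = c₀ + δ. Each
  -- use costs κ/4 of the gap κ, which leaves κ/2 for η.
  set δ := κ / (4 * (p - 1)) with hδdef
  have hδ : 0 < δ := by positivity
  have hδκ : (p - 1) * δ = κ / 4 := by rw [hδdef]; field_simp
  have hd : 0 < c₀ + δ := by positivity
  have hθ : L ^ p * (c₀ + δ) ^ (1 - p) < 1 / (1 + ε) := by
    have h1 : c₀ ^ (p - 1) = L ^ p * (1 + ε) := by
      rw [hc₀, ← Real.rpow_mul (by positivity), one_div_mul_cancel hp1.ne', Real.rpow_one]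
    have h2 : c₀ ^ (p - 1) < (c₀ + δ) ^ (p - 1) :=
      Real.rpow_lt_rpow hc₀0 (by linarith) hp1
    rw [show 1 - p = -(p - 1) by ring, Real.rpow_neg hd.le, ← div_eq_mul_inv,
      div_lt_div_iff₀ (by positivity) (by positivity)]
    linarith
  set η := min (κ / 2) (1 / (1 + ε) - L ^ p * (c₀ + δ) ^ (1 - p)) with hη
  have hη0 : 0 < η := lt_min (by positivity) (by linarith)
  refine ⟨(max 1 (δ ^ (1 - p))).toNNReal, (max 1 (δ ^ (1 - p)) / η).toNNReal, ?_⟩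
  intro T _ Ω _ P _ _ K _ _ N c hA ξ f hH Y Z hmem hsol
  have hnorm := hsol.normLp_eq hp hβ0 hA
  have hfin := hmem.norm_lt_top.ne
  rw [hnorm] at hfin
  have hξ : ∫⁻ ω, ENNReal.ofReal (|ξ ω| ^ p * Real.exp (β * c.A ω ⊤)) ∂P ≠ ∞ := by
    simpa only [mul_comm] using hH.integrable_ξ.ne
  have main := fun t => estimate_of_le hp hL hL' hε hδ hd hη0
    (by
      have := min_le_left (κ / 2) (1 / (1 + ε) - L ^ p * (c₀ + δ) ^ (1 - p))
      rw [mul_add, hδκ]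
      linarith)
    (by
      have := min_le_right (κ / 2) (1 / (1 + ε) - L ^ p * (c₀ + δ) ^ (1 - p))
      linarith)
    (ne_top_of_le_ne_top (ENNReal.add_ne_top.1 hfin).1 (expIntegral_le_bot c t _))
    (ne_top_of_le_ne_top (ENNReal.add_ne_top.1 hfin).2 (expIntegral_le_bot c t _)) hξ
    (hH.expIntegral_f_zero_ne_top t) (hsol.lintegral_le hH hp hβ0 hL hL' hδ hd hA t)
    (rpow_abs_Z_le hp hε hsol t)
  refine ⟨fun t => ?_, ?_⟩
  · rw [hH.dataBound_eq]
    exact (main t).1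
  · rw [hH.dataBound_eq, hnorm]
    -- At t = ⊥ the integrals over (t, T] are the full norms.
    exact (main ⊥).2
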